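/- For an integer $N\ge 2$ let $$\Omega_N=\{x=(x_1,\dots,x_{N-1})\in\mathbb R^{N-1}:\ 0\le x_1\le\dots\le x_{N-1}\le N\},\qquad x_0:=0,\quad x_N:=N,$$ and for $\alpha>0$ let $\rho_\alpha(u)=\frac{\Gamma(2\alpha)}{\Gamma(\alpha)^2}[u(1-u)]^{\alpha-1}$, $u\in[0,1]$, be the density of the symmetric Beta law. Consider the continuous-time Markov chain on $\Omega_N$ in which, independently for each $k\in\{1,\dots,N-1\}$, at rate $1$ the coordinate $x_k$ is replaced by $u\,x_{k-1}+(1-u)\,x_{k+1}$ with a fresh random $u$ of density $\rho_\alpha$; that is, the chain with generator $$(\mathcal L_{N,\alpha}f)(x)=\sum_{k=1}^{N-1}\int_0^1\bigl(f(x^{(k,u)})-f(x)\bigr)\rho_\alpha(u)\,du,$$ where $x^{(k,u)}_j=x_j$ for $j\ne k$ and $x^{(k,u)}_k=u\,x_{k-1}+(1-u)\,x_{k+1}$. Let $P^x_t$ be its law at time $t$ when started from $x$, let $$\pi_{N,\alpha}(dx)=\frac{\Gamma(N\alpha)}{\Gamma(\alpha)^N N^{N\alpha-1}}\prod_{k=1}^N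 (x_k-x_{k-1})^{\alpha-1}\,dx$$ be its equilibrium measure on $\Omega_N$, and define, for $\varepsilon>0$, $$T_{N,\alpha}(\varepsilon)=\inf\Bigl\{t\ge 0:\ \sup_{x\in\Omega_N}\|P^x_t-\pi_{N,\alpha}\|_{TV}<\varepsilon\Bigr\},\qquad \|\mu-\nu\|_{TV}=\sup_{B\subset\Omega_N\text{ Borel}}(\mu(B)-\nu(B)),$$ with $\inf\emptyset=+\infty$. Put $\mathrm{gap}_N=1-\cos(\pi/N)$. Then for every $\alpha\ge 1$ and every $\varepsilon>0$ there is $N_0=N_0(\alpha,\varepsilon)$ such that for all $N\ge N_0$, $$T_{N,\alpha}(\varepsilon)\ \le\ \frac{5\log N}{\mathrm{gap}_N}.$$ -/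

import Mathlib

open MeasureTheory ProbabilityTheory Filter
open scoped ENNReal

namespace BetaSimplex

noncomputable section

/-- Configurations `(x_1, …, x_{N-1})`; the coordinate with index `i : Fin (N - 1)` is `x_{i+1}`. -/
abbrev Config (N : ℕ) : Type := Fin (N - 1) → ℝ

/-- `pos N x k` is `x_k` for `0 ≤ k ≤ N`, with the convention `x_0 = 0` and `x_N = N`. -/
def pos (N : ℕ) (x : Config N) (k : ℕ) : ℝ :=
  if k = 0 then 0 else if h : k - 1 < N - 1 then x ⟨k - 1, h⟩ else (N : ℝ)

/-- The simplex `Ω_N = {x : 0 ≤ x_1 ≤ ⋯ ≤ x_{N-1} ≤ N}`. -/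
def Omega (N : ℕ) : Set (Config N) :=
  {x | ∀ k < N, pos N x k ≤ pos N x (k + 1)}

/-- The update `x ↦ x^{(k,u)}` at the site `k = i + 1`: the coordinate `x_k` is replaced by
`u x_{k-1} + (1 - u) x_{k+1}`. -/
def resample (N : ℕ) (i : Fin (N - 1)) (u : ℝ) (x : Config N) : Config N :=
  Function.update x i (u * pos N x (i : ℕ) + (1 - u) * pos N x ((i : ℕ) + 2))

/-- The generator
`(L f)(x) = ∑_k ∫ (f (x^{(k,u)}) - f x) ρ_α(u) du`, where `ρ_α(u) du` is the symmetric Beta law of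
parameter `α` on `[0, 1]`. -/
def generator (N : ℕ) (α : ℝ) (f : Config N → ℝ) (x : Config N) : ℝ :=
  ∑ i : Fin (N - 1), ∫ u, (f (resample N i u x) - f x) ∂(betaMeasure α α)

lemma measurable_pos (N : ℕ) (k : ℕ) : Measurable fun x : Config N => pos N x k := by
  unfold pos
  split_ifs
  · exact measurable_const
  · exact measurable_pi_apply _
  · exact measurable_const

lemma measurable_resample (N : ℕ) (i : Fin (N - 1)) :
    Measurable fun p : Config N × ℝ => resample N i p.2 p.1 := by
  refine measurable_pi_lambda _ fun j => ?_
  have h1 : Measurable fun p : Config N × ℝ => pos N p.1 (i : ℕ) :=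
    (measurable_pos N (i : ℕ)).comp measurable_fst
  have h2 : Measurable fun p : Config N × ℝ => pos N p.1 ((i : ℕ) + 2) :=
    (measurable_pos N ((i : ℕ) + 2)).comp measurable_fst
  by_cases h : j = i
  · subst h
    simp only [resample, Function.update_self]
    fun_prop
  · simp only [resample, Function.update_of_ne h]
    fun_prop

instance sFinite_betaMeasure (α : ℝ) : SFinite (betaMeasure α α) := by
  unfold betaMeasure; infer_instance

/-- The law of `x^{(k,u)}`, `k = i + 1`, when `u` has the symmetric Beta law of parameter `α`. -/
def siteKernel (N : ℕ) (α : ℝ) (i : Fin (N - 1)) : Kernel (Config N) (Config N) where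
  toFun x := (betaMeasure α α).map fun u => resample N i u x
  measurable' := by
    have h : (fun x : Config N => (betaMeasure α α).map fun u => resample N i u x) =
        fun x => ((betaMeasure α α).map (Prod.mk x)).map
          fun p : Config N × ℝ => resample N i p.2 p.1 := by
      funext x
      rw [Measure.map_map (measurable_resample N i) measurable_prodMk_left]
      rfl
    rw [h]
    exact (Measure.measurable_map _ (measurable_resample N i)).comp Measurable.map_prodMk_left

/-- `S^n` for `S = ∑_i K_i`, the sum of the site kernels: the sum over all `i_1, …, i_n` of the law
obtained by resampling successively at the sites `i_1, …, i_n`. -/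
def updates (N : ℕ) (α : ℝ) : ℕ → Kernel (Config N) (Config N)
  | 0 => Kernel.id
  | n + 1 => (∑ i : Fin (N - 1), siteKernel N α i) ∘ₖ updates N α n

/-- The law `P_t^x` of the continuous-time chain at time `t ≥ 0` started from `x`, in which each of
the `N - 1` sites is resampled independently at rate `1`. Since the generator is the bounded
operator `L = S - (N - 1)`, this is
`e^{tL} = e^{-(N-1)t} ∑_n (t^n / n!) S^n`; the three facts proved after this definition say
that this is the transition function of the Markov chain with generator `L`. -/
def law (N : ℕ) (α t : ℝ) (x : Config N) : Measure (Config N) :=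
  Measure.sum fun n : ℕ =>
    ENNReal.ofReal (Real.exp (-(((N - 1 : ℕ) : ℝ) * t)) * (t ^ n / (n.factorial : ℝ))) •
      updates N α n x

lemma siteKernel_apply (N : ℕ) (α : ℝ) (i : Fin (N - 1)) (x : Config N) :
    siteKernel N α i x = (betaMeasure α α).map fun u => resample N i u x := rfl

lemma measurable_resample_right (N : ℕ) (i : Fin (N - 1)) (x : Config N) :
    Measurable fun u : ℝ => resample N i u x :=
  (measurable_resample N i).comp measurable_prodMk_left

lemma isMarkovKernel_siteKernel (N : ℕ) {α : ℝ} (hα : 0 < α) (i : Fin (N - 1)) :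
    IsMarkovKernel (siteKernel N α i) := by
  have := isProbabilityMeasureBeta hα hα
  exact ⟨fun x => Measure.isProbabilityMeasure_map (measurable_resample_right N i x).aemeasurable⟩

lemma sum_siteKernel_univ (N : ℕ) {α : ℝ} (hα : 0 < α) (x : Config N) :
    (∑ i : Fin (N - 1), siteKernel N α i) x Set.univ = ((N - 1 : ℕ) : ℝ≥0∞) := by
  have := fun i => isMarkovKernel_siteKernel N hα i
  simp

lemma isFiniteKernel_sum (N : ℕ) {α : ℝ} (hα : 0 < α) :
    IsFiniteKernel (∑ i : Fin (N - 1), siteKernel N α i) :=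
  ⟨⟨((N - 1 : ℕ) : ℝ≥0∞), ENNReal.natCast_lt_top _, fun x => (sum_siteKernel_univ N hα x).le⟩⟩

lemma updates_univ (N : ℕ) {α : ℝ} (hα : 0 < α) (n : ℕ) (x : Config N) :
    updates N α n x Set.univ = ((N - 1 : ℕ) : ℝ≥0∞) ^ n := by
  induction n with
  | zero => simp [updates]
  | succ n ih =>
    rw [updates, Kernel.comp_apply' _ _ _ MeasurableSet.univ]
    simp only [sum_siteKernel_univ N hα, lintegral_const, ih]
    rw [pow_succ, mul_comm]

lemma isFiniteMeasure_updates (N : ℕ) {α : ℝ} (hα : 0 < α) (n : ℕ) (x : Config N) :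
    IsFiniteMeasure (updates N α n x) :=
  ⟨by rw [updates_univ N hα]; exact ENNReal.pow_lt_top (ENNReal.natCast_lt_top _)⟩

theorem isProbabilityMeasure_law (N : ℕ) {α : ℝ} (hα : 0 < α) {t : ℝ} (ht : 0 ≤ t) (x : Config N) :
    IsProbabilityMeasure (law N α t x) := by
  constructor
  rw [law, Measure.sum_apply _ MeasurableSet.univ]
  simp only [Measure.smul_apply, smul_eq_mul, updates_univ N hα]
  set c : ℝ := ((N - 1 : ℕ) : ℝ) with hc
  have hc0 : 0 ≤ c := Nat.cast_nonneg _
  have h : ∀ n : ℕ, ENNReal.ofReal (Real.exp (-(c * t)) * (t ^ n / (n.factorial : ℝ))) *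
      ((N - 1 : ℕ) : ℝ≥0∞) ^ n =
      ENNReal.ofReal (Real.exp (-(c * t)) * ((c * t) ^ n / (n.factorial : ℝ))) := by
    intro n
    have : ((N - 1 : ℕ) : ℝ≥0∞) ^ n = ENNReal.ofReal (c ^ n) := by
      rw [ENNReal.ofReal_pow hc0, hc, ENNReal.ofReal_natCast]
    rw [this, ← ENNReal.ofReal_mul (by positivity)]
    congr 1
    rw [mul_pow]; ring
  simp only [h]
  have hs : HasSum (fun n : ℕ => Real.exp (-(c * t)) * ((c * t) ^ n / (n.factorial : ℝ))) 1 := by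
    have := (NormedSpace.expSeries_div_hasSum_exp (c * t)).mul_left (Real.exp (-(c * t)))
    rwa [← Real.exp_eq_exp_ℝ, ← Real.exp_add, neg_add_cancel, Real.exp_zero] at this
  rw [← ENNReal.ofReal_tsum_of_nonneg (fun n => by positivity) hs.summable, hs.tsum_eq,
    ENNReal.ofReal_one]

theorem law_zero (N : ℕ) (α : ℝ) (x : Config N) : law N α 0 x = Measure.dirac x := by
  ext s hs
  rw [law, Measure.sum_apply _ hs, tsum_eq_single 0]
  · simp [updates, Kernel.id_apply]
  · intro n hn
    simp [hn]

lemma generator_eq (N : ℕ) {α : ℝ} (hα : 0 < α) {f : Config N → ℝ} (hf : Measurable f) {M : ℝ}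
    (hM : ∀ x, |f x| ≤ M) (x : Config N) :
    generator N α f x =
      ∫ y, f y ∂((∑ i : Fin (N - 1), siteKernel N α i) x) - ((N - 1 : ℕ) : ℝ) * f x := by
  have := fun i => isMarkovKernel_siteKernel N hα i
  have := isProbabilityMeasureBeta hα hα
  rw [show (∑ i : Fin (N - 1), siteKernel N α i) x = ∑ i : Fin (N - 1), siteKernel N α i x by
    simp, integral_finsetSum_measure]
  · have h : ∀ i : Fin (N - 1), ∫ u, (f (resample N i u x) - f x) ∂(betaMeasure α α) =
        ∫ y, f y ∂(siteKernel N α i x) - f x := by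
      intro i
      rw [siteKernel_apply, integral_map (measurable_resample_right N i x).aemeasurable
        hf.aestronglyMeasurable, integral_sub _ (integrable_const _)]
      · simp
      · exact Integrable.of_bound
          (hf.comp (measurable_resample_right N i x)).aestronglyMeasurable M
          (ae_of_all _ fun u => hM _)
    simp only [generator, h, Finset.sum_sub_distrib, Finset.sum_const, Finset.card_univ,
      Fintype.card_fin, nsmul_eq_mul]
  · intro i _
    exact Integrable.of_bound hf.aestronglyMeasurable M (ae_of_all _ fun u => hM _)

lemma integral_law (N : ℕ) {α : ℝ} (hα : 0 < α) {f : Config N → ℝ} (hf : Measurable f) {M : ℝ}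
    (hM : ∀ x, |f x| ≤ M) {t : ℝ} (ht : 0 ≤ t) (x : Config N) :
    HasSum (fun n : ℕ => Real.exp (-(((N - 1 : ℕ) : ℝ) * t)) * (t ^ n / (n.factorial : ℝ)) *
      ∫ y, f y ∂(updates N α n x)) (∫ y, f y ∂(law N α t x)) := by
  have := isProbabilityMeasure_law N hα ht x
  have hi : Integrable f (law N α t x) :=
    Integrable.of_bound hf.aestronglyMeasurable M (ae_of_all _ fun u => hM _)
  have h : ∀ n : ℕ, 0 ≤ Real.exp (-(((N - 1 : ℕ) : ℝ) * t)) * (t ^ n / (n.factorial : ℝ)) :=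
    fun n => by positivity
  have := hasSum_integral_measure hi
  simp only [integral_smul_measure, ENNReal.toReal_ofReal (h _), smul_eq_mul] at this
  exact this

lemma abs_integral_updates_le (N : ℕ) {α : ℝ} (hα : 0 < α) {f : Config N → ℝ} {M : ℝ}
    (hM : ∀ x, |f x| ≤ M) (n : ℕ) (x : Config N) :
    |∫ y, f y ∂(updates N α n x)| ≤ M * ((N - 1 : ℕ) : ℝ) ^ n := by
  have := isFiniteMeasure_updates N hα n x
  have h := norm_integral_le_of_norm_le_const (μ := updates N α n x)
    (ae_of_all _ fun y => (Real.norm_eq_abs (f y)).trans_le (hM y))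
  rwa [Measure.real, updates_univ N hα, ENNReal.toReal_pow, ENNReal.toReal_natCast] at h

lemma hasDerivAt_expSeries {a : ℕ → ℝ} {M c : ℝ} (_hM : 0 ≤ M) (_hc : 0 ≤ c)
    (ha : ∀ n, |a n| ≤ M * c ^ n) (t : ℝ) :
    HasDerivAt (fun s : ℝ => ∑' n : ℕ, s ^ n / (n.factorial : ℝ) * a n)
      (∑' n : ℕ, t ^ n / (n.factorial : ℝ) * a (n + 1)) t := by
  set R : ℝ := |t| + 1 with hR
  have hR0 : 0 ≤ R := by positivity
  have hd : ∀ (n : ℕ) (s : ℝ), HasDerivAt (fun s : ℝ => s ^ n / (n.factorial : ℝ) * a n)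
      ((n : ℝ) * s ^ (n - 1) / (n.factorial : ℝ) * a n) s := fun n s =>
    ((hasDerivAt_pow n s).div_const _).mul_const _
  have hsucc : ∀ (n : ℕ) (s : ℝ), ((n + 1 : ℕ) : ℝ) * s ^ (n + 1 - 1) / ((n + 1).factorial : ℝ) =
      s ^ n / (n.factorial : ℝ) := by
    intro n s
    have h1 : ((n + 1 : ℕ) : ℝ) ≠ 0 := by positivity
    rw [Nat.factorial_succ, Nat.cast_mul, Nat.add_sub_cancel, mul_div_mul_left _ _ h1]
  have hu : Summable fun n : ℕ => (n : ℝ) * R ^ (n - 1) / (n.factorial : ℝ) * (M * c ^ n) := by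
    rw [← summable_nat_add_iff 1]
    have := (Real.summable_pow_div_factorial (R * c)).mul_left (M * c)
    refine this.congr fun n => ?_
    rw [hsucc, mul_pow, pow_succ]; ring
  have key := hasDerivAt_tsum_of_isPreconnected hu Metric.isOpen_ball
    (convex_ball (0 : ℝ) R).isPreconnected (fun n s _ => hd n s) (fun n s hs => ?_)
    (Metric.mem_ball_self (by positivity : (0 : ℝ) < R))
    (summable_of_ne_finset_zero (s := {0}) fun n hn => by
      have : n ≠ 0 := by simpa using hn
      simp [this])
    (by simp [hR] : t ∈ Metric.ball (0 : ℝ) R)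
  · have hs : Summable fun n : ℕ => (n : ℝ) * t ^ (n - 1) / (n.factorial : ℝ) * a n := by
      refine Summable.of_norm_bounded hu fun n => ?_
      rw [norm_mul, norm_div, norm_mul, norm_pow, Real.norm_natCast, Real.norm_natCast,
        Real.norm_eq_abs, Real.norm_eq_abs]
      gcongr
      · simp [hR]
      · exact ha n
    rw [hs.tsum_eq_zero_add] at key
    simpa only [hsucc, Nat.cast_zero, zero_mul, zero_div, zero_add] using key
  · have hs' : |s| ≤ R := by
      have := Metric.mem_ball.1 hs
      rw [Real.dist_eq, sub_zero] at this
      exact this.le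
    rw [norm_mul, norm_div, norm_mul, norm_pow, Real.norm_natCast, Real.norm_natCast,
      Real.norm_eq_abs, Real.norm_eq_abs]
    gcongr
    exact ha n

/-- Kolmogorov's equation `d/dt P_t f = P_t (L f)` for every bounded measurable `f`. -/
theorem hasDerivWithinAt_integral_law (N : ℕ) {α : ℝ} (hα : 0 < α) {f : Config N → ℝ}
    (hf : Measurable f) {M : ℝ} (hM : ∀ x, |f x| ≤ M) {t : ℝ} (ht : 0 ≤ t) (x : Config N) :
    HasDerivWithinAt (fun s => ∫ y, f y ∂(law N α s x))
      (∫ y, generator N α f y ∂(law N α t x)) (Set.Ici 0) t := by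
  have := isFiniteKernel_sum N hα
  have hM0 : 0 ≤ M := (abs_nonneg _).trans (hM x)
  set c : ℝ := ((N - 1 : ℕ) : ℝ) with hc
  have hc0 : 0 ≤ c := Nat.cast_nonneg _
  set S := ∑ i : Fin (N - 1), siteKernel N α i with hS
  set a : ℕ → ℝ := fun n => ∫ y, f y ∂(updates N α n x) with ha
  have haM : ∀ n, |a n| ≤ M * c ^ n := fun n => abs_integral_updates_le N hα hM n x
  have hSm : Measurable fun y => ∫ z, f z ∂(S y) :=
    (hf.stronglyMeasurable.integral_kernel).measurable
  have hSb : ∀ y, |∫ z, f z ∂(S y)| ≤ M * c := by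
    intro y
    have h := norm_integral_le_of_norm_le_const (μ := S y)
      (ae_of_all _ fun z => (Real.norm_eq_abs (f z)).trans_le (hM z))
    rw [Measure.real, hS, sum_siteKernel_univ N hα y, ENNReal.toReal_natCast] at h
    exact h
  have hgen : generator N α f = fun y => ∫ z, f z ∂(S y) - c * f y :=
    funext fun y => generator_eq N hα hf hM y
  have hgm : Measurable (generator N α f) := by rw [hgen]; fun_prop
  have hgb : ∀ y, |generator N α f y| ≤ M * c + c * M := by
    intro y
    rw [hgen]
    refine (abs_sub _ _).trans (add_le_add (hSb y) ?_)
    rw [abs_mul, abs_of_nonneg hc0]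
    exact mul_le_mul_of_nonneg_left (hM y) hc0
  have hgu : ∀ n, ∫ y, generator N α f y ∂(updates N α n x) = a (n + 1) - c * a n := by
    intro n
    have := isFiniteMeasure_updates N hα n x
    have := isFiniteMeasure_updates N hα (n + 1) x
    rw [hgen, integral_sub, integral_const_mul]
    · congr 1
      simp only [ha]
      rw [updates, Kernel.integral_comp]
      exact Integrable.of_bound (μ := updates N α (n + 1) x) hf.aestronglyMeasurable M
        (ae_of_all _ fun u => hM _)
    · exact Integrable.of_bound hSm.aestronglyMeasurable (M * c) (ae_of_all _ fun u => hSb _)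
    · exact (Integrable.of_bound hf.aestronglyMeasurable M
        (ae_of_all _ fun u => hM _)).const_mul c
  have hsum : ∀ (b : ℕ → ℝ) (K : ℝ), (∀ n, |b n| ≤ K * c ^ n) → ∀ s : ℝ,
      Summable fun n : ℕ => s ^ n / (n.factorial : ℝ) * b n := by
    intro b K hb s
    refine Summable.of_norm_bounded ((Real.summable_pow_div_factorial (|s| * c)).mul_left K)
      fun n => ?_
    rw [norm_mul, norm_div, norm_pow, Real.norm_natCast, Real.norm_eq_abs, Real.norm_eq_abs]
    calc |s| ^ n / (n.factorial : ℝ) * |b n| ≤ |s| ^ n / (n.factorial : ℝ) * (K * c ^ n) := by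
          gcongr; exact hb n
      _ = K * ((|s| * c) ^ n / (n.factorial : ℝ)) := by rw [mul_pow]; ring
  have hlaw : ∀ s : ℝ, 0 ≤ s → ∫ y, f y ∂(law N α s x) =
      Real.exp (-(c * s)) * ∑' n : ℕ, s ^ n / (n.factorial : ℝ) * a n := by
    intro s hs
    rw [← (integral_law N hα hf hM hs x).tsum_eq, ← tsum_mul_left]
    exact tsum_congr fun n => mul_assoc _ _ _
  have hlawg : ∫ y, generator N α f y ∂(law N α t x) =
      Real.exp (-(c * t)) * (∑' n : ℕ, t ^ n / (n.factorial : ℝ) * a (n + 1) -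
        c * ∑' n : ℕ, t ^ n / (n.factorial : ℝ) * a n) := by
    rw [← (integral_law N hα hgm hgb ht x).tsum_eq, ← tsum_mul_left (a := c),
      ← (hsum (fun n => a (n + 1)) (M * c) (fun n => (haM (n + 1)).trans_eq (by ring)) t).tsum_sub
        ((hsum a M haM t).mul_left c), ← tsum_mul_left]
    refine tsum_congr fun n => ?_
    rw [hgu]; ring
  have hD := ((((hasDerivAt_id t).const_mul c).neg.exp).mul
    (hasDerivAt_expSeries hM0 hc0 haM t)).hasDerivWithinAt (s := Set.Ici 0)
  refine (hD.congr_of_mem (fun s hs => ?_) ht).congr_deriv ?_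
  · simpa using hlaw s hs
  · rw [hlawg]; simp; ring

/-- The equilibrium measure
`π_{N,α}(dx) = Γ(Nα) / (Γ(α)^N N^{Nα-1}) ∏_{k=1}^N (x_k - x_{k-1})^{α-1} dx` on `Ω_N`. -/
def equilibrium (N : ℕ) (α : ℝ) : Measure (Config N) :=
  (volume.restrict (Omega N)).withDensity fun x =>
    ENNReal.ofReal (Real.Gamma (N * α) / (Real.Gamma α ^ N * (N : ℝ) ^ (N * α - 1)) *
      ∏ k ∈ Finset.range N, (pos N x (k + 1) - pos N x k) ^ (α - 1))

/-- The total variation distance `‖μ - ν‖ = sup_B (μ(B) - ν(B))` of two probability measures on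
`Ω_N`, the supremum ranging over all Borel subsets `B` of `Ω_N`. -/
def tvDist (N : ℕ) (μ ν : Measure (Config N)) : ℝ :=
  ⨆ B : {B : Set (Config N) // MeasurableSet B ∧ B ⊆ Omega N}, (μ.real B - ν.real B)

/-- `d_{N,α}(t) = sup_{x ∈ Ω_N} ‖P_t^x - π_{N,α}‖`. -/
def worstDist (N : ℕ) (α t : ℝ) : ℝ :=
  ⨆ x : Omega N, tvDist N (law N α t x) (equilibrium N α)

/-- The mixing time `T_{N,α}(ε) = inf {t ≥ 0 : d_{N,α}(t) < ε}`, as an extended real number, so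
that the infimum of the empty set is `+∞`. -/
def mixingTime (N : ℕ) (α ε : ℝ) : EReal :=
  sInf ((fun t : ℝ => (t : EReal)) '' {t : ℝ | 0 ≤ t ∧ worstDist N α t < ε})

/-- `gap_N = 1 - cos (π / N)`. -/
def gap (N : ℕ) : ℝ := 1 - Real.cos (Real.pi / N)

end

end BetaSimplex

namespace BetaSimplex

/-! The chain jumps at the times of a Poisson process of rate `N - 1`, each jump being one
application of `average`, so it is enough to compare `(average N α)^[n] f x` with the equilibrium
mean of `f`, for `f` an indicator. No coupling is ever constructed: it is replaced by an inequality
`g x ≤ g y + cost x y + H y` on the simplex, propagated through `average`. Since `H` depends on `y`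
alone, integrating `y` against the invariant measure turns it into a constant.

The run of the chain has two phases. In the long first phase both configurations use the same site
and the same `u`. The weights `sin (kπ/N)` form the first Dirichlet eigenfunction of the discrete
Laplacian, so the weighted `ℓ¹` distance contracts by `1 - gap N / (N - 1)` per step
(`average_contraction`).

In the last `m` steps the updated site is made to agree (`siteAverage_coupling`). For `α ≥ 1` a Beta
law dominates a multiple of each of its affine contractions, hence two Beta laws on nearby intervals
share most of their mass. The merge fails with probability at most a constant times (displacement of
the neighbours)`/s`, unless the interval of `y` is shorter than `s`; at equilibrium that has
probability `O(s)` (`equilibrium_interval_lt`). Once every differing site has been merged, the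
configurations coincide.

With `m` of order `N^(5/4)` and `s = N^(-3/2)`, the prefactor of the distance term is `O(N^(19/4))`,
while the Poisson average of the contraction at time `5 log N / gap N` is `N^(-5)`. All errors are
then `O(N^(-1/4))`. -/

/-! ### The symmetric Beta law: minorization, reflection, mean. -/

lemma lintegral_affine (g : ℝ → ℝ≥0∞) (p : ℝ) {q : ℝ} (hq : q ≠ 0) :
    ∫⁻ z, g z = ENNReal.ofReal |q| * ∫⁻ u, g (p + q * u) := by
  have hinj : Function.Injective fun u : ℝ => p + q * u := fun u v h =>
    mul_left_cancel₀ hq (add_left_cancel h)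
  have hsurj : (fun u : ℝ => p + q * u) '' Set.univ = Set.univ := by
    rw [Set.image_univ]
    refine Set.range_eq_univ.2 fun z => ⟨(z - p) / q, ?_⟩
    field_simp
    ring
  have h := lintegral_image_eq_lintegral_abs_deriv_mul (s := Set.univ) (f := fun u => p + q * u)
    (f' := fun _ => q) MeasurableSet.univ
    (fun u _ => ((((hasDerivAt_id u).const_mul q).const_add p).congr_deriv
      (mul_one q)).hasDerivWithinAt)
    hinj.injOn g
  rw [hsurj, setLIntegral_univ, setLIntegral_univ] at h
  rw [h, lintegral_const_mul' _ _ ENNReal.ofReal_ne_top]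

lemma lintegral_betaMeasure (a b : ℝ) {G : ℝ → ℝ≥0∞} (hG : Measurable G) :
    ∫⁻ u, G u ∂(betaMeasure a b) = ∫⁻ u, betaPDF a b u * G u := by
  rw [betaMeasure, lintegral_withDensity_eq_lintegral_mul _ (by unfold betaPDF; fun_prop) hG]
  rfl

lemma ae_betaMeasure (a b : ℝ) : ∀ᵐ u ∂(betaMeasure a b), 0 < u ∧ u < 1 := by
  rw [betaMeasure, ae_withDensity_iff (by unfold betaPDF; fun_prop)]
  refine ae_of_all _ fun u hu => ?_
  constructor
  · by_contra h
    exact hu (betaPDF_eq_zero_of_nonpos (not_lt.1 h))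
  · by_contra h
    exact hu (betaPDF_eq_zero_of_one_le (not_lt.1 h))

/-- The Beta law dominates a multiple of each of its affine contractions. -/
lemma betaMeasure_minorization {α : ℝ} (hα : 1 ≤ α) {p q : ℝ} (hp : 0 ≤ p) (hq : 0 < q)
    (hpq : p + q ≤ 1) {G : ℝ → ℝ≥0∞} (hG : Measurable G) :
    ENNReal.ofReal (q ^ (2 * α - 1)) * ∫⁻ u, G (p + q * u) ∂(betaMeasure α α) ≤
      ∫⁻ u, G u ∂(betaMeasure α α) := by
  -- In `q ^ (2 * α - 1)` one factor `q` is the Jacobian; the two factors `q ^ (α - 1)` are the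
  -- price of comparing the two factors of the density.
  rw [lintegral_betaMeasure α α hG, lintegral_betaMeasure α α (by fun_prop),
    lintegral_affine (fun u => betaPDF α α u * G u) p hq.ne', abs_of_pos hq,
    show q ^ (2 * α - 1) = q * (q ^ (α - 1) * q ^ (α - 1)) by
      rw [← Real.rpow_add hq, ← Real.rpow_one_add' hq.le (by linarith)]; congr 1; ring,
    ENNReal.ofReal_mul hq.le, mul_assoc]
  refine mul_le_mul_right ?_ (ENNReal.ofReal q)
  rw [← lintegral_const_mul' _ _ ENNReal.ofReal_ne_top]
  refine lintegral_mono fun u => ?_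
  rw [← mul_assoc]
  refine mul_le_mul_left ?_ _
  by_cases hu : 0 < u ∧ u < 1
  -- The contraction moves a point away from both ends of `[0, 1]`, relative to scaling alone; `α ≥
  -- 1` makes the powers monotone, so the density can only gain.
  · have h1 : q * u ≤ p + q * u := by linarith
    have h2 : q * (1 - u) ≤ 1 - (p + q * u) := by linarith
    have h3 : 0 < q * u := mul_pos hq hu.1
    have h4 : 0 < q * (1 - u) := mul_pos hq (by linarith [hu.2])
    have hb := beta_pos (by linarith : 0 < α) (by linarith : 0 < α)
    rw [betaPDF_of_pos_lt_one hu.1 hu.2, betaPDF_of_pos_lt_one (by linarith) (by linarith),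
      ← ENNReal.ofReal_mul (by positivity)]
    refine ENNReal.ofReal_le_ofReal ?_
    calc q ^ (α - 1) * q ^ (α - 1) * (1 / beta α α * u ^ (α - 1) * (1 - u) ^ (α - 1))
        = 1 / beta α α * (q * u) ^ (α - 1) * (q * (1 - u)) ^ (α - 1) := by
          rw [Real.mul_rpow hq.le hu.1.le, Real.mul_rpow hq.le (by linarith [hu.2])]; ring
      _ ≤ _ := by
          have := Real.rpow_le_rpow h3.le h1 (by linarith : 0 ≤ α - 1)
          have := Real.rpow_le_rpow h4.le h2 (by linarith : 0 ≤ α - 1)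
          have : 0 ≤ p + q * u := h3.le.trans h1
          gcongr
  · have : betaPDF α α u = 0 := by simp [betaPDF_eq, hu]
    simp [this]

lemma lintegral_betaMeasure_reflect (α : ℝ) {G : ℝ → ℝ≥0∞} (hG : Measurable G) :
    ∫⁻ u, G (1 - u) ∂(betaMeasure α α) = ∫⁻ u, G u ∂(betaMeasure α α) := by
  rw [lintegral_betaMeasure α α hG, lintegral_betaMeasure α α (by fun_prop),
    lintegral_affine (fun u => betaPDF α α u * G u) 1 (q := -1) (by norm_num)]
  simp only [abs_neg, abs_one, ENNReal.ofReal_one, one_mul]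
  refine lintegral_congr fun u => ?_
  rw [show (1 : ℝ) + -1 * u = 1 - u by ring]
  congr 1
  rw [betaPDF_eq, betaPDF_eq]
  congr 1
  by_cases hu : 0 < u ∧ u < 1
  · rw [if_pos hu, if_pos ⟨by linarith [hu.2], by linarith [hu.1]⟩, sub_sub_cancel]; ring
  · rw [if_neg hu, if_neg fun h => hu ⟨by linarith [h.2], by linarith [h.1]⟩]

lemma lintegral_betaMeasure_id {α : ℝ} (hα : 0 < α) :
    ∫⁻ u, ENNReal.ofReal u ∂(betaMeasure α α) = 2⁻¹ := by
  have := isProbabilityMeasureBeta hα hα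
  have h1 := lintegral_betaMeasure_reflect α ENNReal.measurable_ofReal
  have h2 : ∫⁻ u, (ENNReal.ofReal u + ENNReal.ofReal (1 - u)) ∂(betaMeasure α α) = 1 := by
    rw [lintegral_congr_ae (g := fun _ => 1)]
    · simp
    · filter_upwards [ae_betaMeasure α α] with u hu
      rw [← ENNReal.ofReal_add hu.1.le (by linarith [hu.2])]
      simp
  rw [lintegral_add_left ENNReal.measurable_ofReal, h1, ← two_mul] at h2
  exact ENNReal.eq_inv_of_mul_eq_one_left (by rwa [mul_comm])

lemma lintegral_betaMeasure_convex {α : ℝ} (hα : 0 < α) {a b : ℝ} (ha : 0 ≤ a) (hb : 0 ≤ b) :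
    ∫⁻ u, ENNReal.ofReal (u * a + (1 - u) * b) ∂(betaMeasure α α) =
      ENNReal.ofReal ((a + b) / 2) := by
  have h : ∀ᵐ u ∂(betaMeasure α α), ENNReal.ofReal (u * a + (1 - u) * b) =
      ENNReal.ofReal u * ENNReal.ofReal a + ENNReal.ofReal (1 - u) * ENNReal.ofReal b := by
    filter_upwards [ae_betaMeasure α α] with u hu
    have h1 : 0 ≤ 1 - u := by linarith [hu.2]
    rw [ENNReal.ofReal_add (mul_nonneg hu.1.le ha) (mul_nonneg h1 hb), ENNReal.ofReal_mul hu.1.le,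
      ENNReal.ofReal_mul h1]
  rw [lintegral_congr_ae h, lintegral_add_left (by fun_prop),
    lintegral_mul_const _ (by fun_prop), lintegral_mul_const _ (by fun_prop),
    lintegral_betaMeasure_reflect α ENNReal.measurable_ofReal, lintegral_betaMeasure_id hα,
    ← mul_add, ← ENNReal.ofReal_add ha hb, div_eq_inv_mul, ENNReal.ofReal_mul (by positivity),
    ENNReal.ofReal_inv_of_pos two_pos]
  simp

/-! ### Gamma kernels and the Dirichlet integral. -/

noncomputable section

/-- The function `η ↦ η^(a-1) / Γ(a)` on `η ≥ 0`, extended by `0`; these functions form a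
convolution semigroup in `a`. -/
def gammaKernel (a η : ℝ) : ℝ≥0∞ :=
  if η < 0 then 0 else ENNReal.ofReal η ^ (a - 1) * ENNReal.ofReal (Real.Gamma a)⁻¹

end

lemma measurable_gammaKernel (a : ℝ) : Measurable (gammaKernel a) :=
  Measurable.ite measurableSet_Iio measurable_const (by fun_prop)

lemma gammaKernel_of_neg {a η : ℝ} (h : η < 0) : gammaKernel a η = 0 := if_pos h

lemma gammaKernel_of_pos {a η : ℝ} (h : 0 < η) :
    gammaKernel a η = ENNReal.ofReal (η ^ (a - 1) / Real.Gamma a) := by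
  rw [gammaKernel, if_neg h.not_gt, ENNReal.ofReal_rpow_of_pos h, div_eq_mul_inv,
    ENNReal.ofReal_mul (by positivity)]

/-- Including `η = 0`, where `a = 1` relies on `0 ^ 0 = 1`, allows a pointwise identification of the
equilibrium density on the closed simplex. -/
lemma gammaKernel_of_nonneg {a η : ℝ} (ha : 1 ≤ a) (h : 0 ≤ η) :
    gammaKernel a η = ENNReal.ofReal (η ^ (a - 1) / Real.Gamma a) := by
  rw [gammaKernel, if_neg h.not_gt, ENNReal.ofReal_rpow_of_nonneg h (by linarith), div_eq_mul_inv,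
    ENNReal.ofReal_mul (by positivity)]

/-- Substituting `z = u A + (1 - u) B` produces the Beta integral. It serves twice: with `G = 1` it
is the convolution identity behind the Dirichlet normalization, and with general `G` it identifies
the conditional law of one coordinate given its neighbours. As `u` is the weight of the left end, `B
- z` is proportional to `u`, which explains the order in `betaMeasure b a`. -/
lemma lintegral_gammaKernel_mul {a b : ℝ} (ha : 0 < a) (hb : 0 < b) {A B : ℝ} (h : A < B)
    {G : ℝ → ℝ≥0∞} (hG : Measurable G) :
    ∫⁻ z, gammaKernel a (z - A) * gammaKernel b (B - z) * G z =
      gammaKernel (a + b) (B - A) *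
        ∫⁻ u, G (u * A + (1 - u) * B) ∂(betaMeasure b a) := by
  have hBA : 0 < B - A := sub_pos.2 h
  rw [lintegral_affine _ B (q := A - B) (by linarith), lintegral_betaMeasure b a (by fun_prop),
    ← lintegral_const_mul' _ _ ENNReal.ofReal_ne_top, ← lintegral_const_mul'']
  · have h0 : ∀ᵐ u : ℝ, u ≠ 0 := ae_iff.2 (by simp)
    have h1 : ∀ᵐ u : ℝ, u ≠ 1 := ae_iff.2 (by simp)
    refine lintegral_congr_ae ?_
    filter_upwards [h0, h1] with u hu0 hu1
    rw [show B + (A - B) * u = u * A + (1 - u) * B by ring, ← mul_assoc, ← mul_assoc,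
      ← mul_assoc]
    congr 1
    rw [show u * A + (1 - u) * B - A = (B - A) * (1 - u) by ring,
      show B - (u * A + (1 - u) * B) = (B - A) * u by ring]
    by_cases hu : 0 < u ∧ u < 1
    · have hu2 : 0 < 1 - u := by linarith [hu.2]
      have hGa := Real.Gamma_pos_of_pos ha
      have hGb := Real.Gamma_pos_of_pos hb
      have hGab := Real.Gamma_pos_of_pos (add_pos ha hb)
      rw [betaPDF_of_pos_lt_one hu.1 hu.2, gammaKernel_of_pos (mul_pos hBA hu2),
        gammaKernel_of_pos (mul_pos hBA hu.1), gammaKernel_of_pos hBA, abs_sub_comm,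
        abs_of_pos hBA, ← ENNReal.ofReal_mul (by positivity), ← ENNReal.ofReal_mul (by positivity),
        ← ENNReal.ofReal_mul (by positivity)]
      congr 1
      rw [Real.mul_rpow hBA.le hu2.le, Real.mul_rpow hBA.le hu.1.le, beta, add_comm b a,
        show a + b - 1 = 1 + (a - 1) + (b - 1) by ring, Real.rpow_add hBA, Real.rpow_add hBA,
        Real.rpow_one]
      field_simp
    · have : betaPDF b a u = 0 := by simp [betaPDF_eq, hu]
      rw [this]
      rcases lt_or_gt_of_ne hu0 with h | h
      · rw [gammaKernel_of_neg (mul_neg_of_pos_of_neg hBA h)]; simp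
      · have : 1 < u := lt_of_le_of_ne (not_lt.1 fun h' => hu ⟨h, h'⟩) hu1.symm
        rw [gammaKernel_of_neg (η := (B - A) * (1 - u))
          (mul_neg_of_pos_of_neg hBA (by linarith))]; simp
  · unfold betaPDF; fun_prop

lemma lintegral_gammaKernel_mul_of_le {a b A B : ℝ} (h : B ≤ A) (G : ℝ → ℝ≥0∞) :
    ∫⁻ z, gammaKernel a (z - A) * gammaKernel b (B - z) * G z = 0 := by
  have h0 : ∀ᵐ z : ℝ, z ≠ A := ae_iff.2 (by simp)
  rw [lintegral_congr_ae (g := fun _ => 0), lintegral_zero]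
  filter_upwards [h0] with z hz
  rcases lt_or_gt_of_ne hz with h' | h'
  · rw [gammaKernel_of_neg (by linarith)]; simp
  · rw [gammaKernel_of_neg (η := B - z) (by linarith)]; simp

lemma lintegral_gammaKernel_conv {a b : ℝ} (ha : 0 < a) (hb : 0 < b) {L : ℝ} (hL : 0 < L) :
    ∫⁻ z, gammaKernel a z * gammaKernel b (L - z) = gammaKernel (a + b) L := by
  have := isProbabilityMeasureBeta hb ha
  simpa using lintegral_gammaKernel_mul ha hb hL (measurable_const (a := (1 : ℝ≥0∞)))

/-- Below `s` one may pay `s ^ (1/2)` to lower the exponent by `1/2`. Done on two adjacent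
increments, this yields a full factor `s`, and `a - 1/2` stays positive for every `a ≥ 1`. -/
lemma gammaKernel_trunc {a : ℝ} (ha : 1 / 2 < a) {η s : ℝ} (hη : η < s) :
    gammaKernel a η ≤ ENNReal.ofReal (s ^ (1 / 2 : ℝ) * (Real.Gamma (a - 1 / 2) / Real.Gamma a)) *
      gammaKernel (a - 1 / 2) η := by
  have hG := Real.Gamma_pos_of_pos (by linarith : 0 < a)
  have hG' := Real.Gamma_pos_of_pos (by linarith : 0 < a - 1 / 2)
  rcases lt_trichotomy η 0 with h | h | h
  · simp [gammaKernel_of_neg h]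
  · subst h
    rw [gammaKernel, gammaKernel, if_neg (lt_irrefl _), if_neg (lt_irrefl _), ENNReal.ofReal_zero]
    -- At `η = 0` the right side is `⊤` when `a ≤ 1`, and the left side vanishes when `a > 1`.
    rcases lt_trichotomy a 1 with h1 | h1 | h1
    · have : 0 < s ^ (1 / 2 : ℝ) := Real.rpow_pos_of_pos hη _
      rw [ENNReal.zero_rpow_of_neg (by linarith : a - 1 / 2 - 1 < 0), ENNReal.top_mul,
        ENNReal.mul_top]
      · exact le_top
      · exact (ENNReal.ofReal_pos.2 (mul_pos this (div_pos hG' hG))).ne'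
      · simpa using hG'
    · have : 0 < s ^ (1 / 2 : ℝ) := Real.rpow_pos_of_pos hη _
      rw [ENNReal.zero_rpow_of_neg (by linarith : a - 1 / 2 - 1 < 0), ENNReal.top_mul,
        ENNReal.mul_top]
      · exact le_top
      · exact (ENNReal.ofReal_pos.2 (mul_pos this (div_pos hG' hG))).ne'
      · simpa using hG'
    · rw [ENNReal.zero_rpow_of_pos (by linarith : 0 < a - 1)]; simp
  · have hs : 0 < s := h.trans hη
    rw [gammaKernel_of_pos h, gammaKernel_of_pos h, ← ENNReal.ofReal_mul (by positivity)]
    refine ENNReal.ofReal_le_ofReal ?_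
    have h1 : η ^ (a - 1) = η ^ (1 / 2 : ℝ) * η ^ (a - 1 / 2 - 1) := by
      rw [← Real.rpow_add h]; congr 1; ring
    have h2 : η ^ (1 / 2 : ℝ) ≤ s ^ (1 / 2 : ℝ) := by gcongr
    rw [h1]
    calc _ ≤ s ^ (1 / 2 : ℝ) * η ^ (a - 1 / 2 - 1) / Real.Gamma a := by gcongr
      _ = _ := by rw [mul_assoc, div_mul_div_comm, mul_comm (Real.Gamma (a - 1 / 2)),
            mul_div_mul_right _ _ hG'.ne', mul_div_assoc]

noncomputable section

/-- `x_k` for `0 ≤ k ≤ n + 1`, for the configuration `(x_1, …, x_n)` with `x_0 = 0` and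
`x_{n+1} = L`. -/
def pinnedPos (n : ℕ) (L : ℝ) (x : Fin n → ℝ) (k : ℕ) : ℝ :=
  if k = 0 then 0 else if h : k - 1 < n then x ⟨k - 1, h⟩ else L

/-- The unnormalized Dirichlet density with exponents `a_0, …, a_n`. -/
def dirichletWeight (n : ℕ) (a : ℕ → ℝ) (L : ℝ) (x : Fin n → ℝ) : ℝ≥0∞ :=
  ∏ k ∈ Finset.range (n + 1), gammaKernel (a k) (pinnedPos n L x (k + 1) - pinnedPos n L x k)

end

lemma measurable_pinnedPos (n : ℕ) (k : ℕ) :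
    Measurable fun p : ℝ × (Fin n → ℝ) => pinnedPos n p.1 p.2 k := by
  unfold pinnedPos
  split_ifs <;> fun_prop

lemma measurable_dirichletWeight_prod (n : ℕ) (a : ℕ → ℝ) :
    Measurable fun p : ℝ × (Fin n → ℝ) => dirichletWeight n a p.1 p.2 :=
  Finset.measurable_fun_prod _ fun k _ => (measurable_gammaKernel _).comp
    ((measurable_pinnedPos n (k + 1)).sub (measurable_pinnedPos n k))

lemma measurable_dirichletWeight (n : ℕ) (a : ℕ → ℝ) (L : ℝ) :
    Measurable (dirichletWeight n a L) :=
  (measurable_dirichletWeight_prod n a).comp measurable_prodMk_left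

lemma pinnedPos_insertNth_last (n : ℕ) (L z : ℝ) (x : Fin n → ℝ) {k : ℕ} (hk : k ≤ n + 1) :
    pinnedPos (n + 1) L ((Fin.last n).insertNth z x) k = pinnedPos n z x k := by
  unfold pinnedPos
  split_ifs with h0 h1 h2 h2
  · rfl
  · rw [Fin.insertNth_last']
    exact Fin.snoc_castSucc (α := fun _ => ℝ) z x ⟨k - 1, h2⟩
  · have : (⟨k - 1, h1⟩ : Fin (n + 1)) = Fin.last n := by ext; simp; omega
    rw [this, Fin.insertNth_apply_same]
  · omega
  · omega

lemma dirichletWeight_insertNth_last (n : ℕ) (a : ℕ → ℝ) (L z : ℝ) (x : Fin n → ℝ) :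
    dirichletWeight (n + 1) a L ((Fin.last n).insertNth z x) =
      dirichletWeight n a z x * gammaKernel (a (n + 1)) (L - z) := by
  rw [dirichletWeight, Finset.prod_range_succ]
  congr 1
  · refine Finset.prod_congr rfl fun k hk => ?_
    have := Finset.mem_range.1 hk
    rw [pinnedPos_insertNth_last _ _ _ _ (by omega), pinnedPos_insertNth_last _ _ _ _ (by omega)]
  · rw [pinnedPos_insertNth_last _ _ _ _ le_rfl]
    congr 1
    simp [pinnedPos]

/-- The Dirichlet integral. -/
theorem lintegral_dirichletWeight (n : ℕ) {a : ℕ → ℝ} (ha : ∀ k, 0 < a k) {L : ℝ} (hL : L ≠ 0) :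
    ∫⁻ x, dirichletWeight n a L x = gammaKernel (∑ k ∈ Finset.range (n + 1), a k) L := by
  induction n generalizing L with
  | zero =>
    have : ∀ x : Fin 0 → ℝ, dirichletWeight 0 a L x = gammaKernel (a 0) L := by
      intro x
      simp [dirichletWeight, pinnedPos]
    simp only [this, lintegral_const, zero_add, Finset.sum_range_one]
    simp [volume_pi]
  | succ n ih =>
    have hS : 0 < ∑ k ∈ Finset.range (n + 1), a k :=
      Finset.sum_pos (fun k _ => ha k) ⟨0, by simp⟩
    have h1 := ((volume_preserving_piFinSuccAbove (fun _ : Fin (n + 1) => ℝ)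
      (Fin.last n)).symm).lintegral_comp (measurable_dirichletWeight (n + 1) a L)
    rw [← h1]
    have h2 : ∀ p : ℝ × (Fin n → ℝ), dirichletWeight (n + 1) a L
        ((MeasurableEquiv.piFinSuccAbove (fun _ : Fin (n + 1) => ℝ) (Fin.last n)).symm p) =
        dirichletWeight n a p.1 p.2 * gammaKernel (a (n + 1)) (L - p.1) := fun p =>
      dirichletWeight_insertNth_last n a L p.1 p.2
    simp only [h2]
    rw [Measure.volume_eq_prod, lintegral_prod (fun p : ℝ × (Fin n → ℝ) =>
      dirichletWeight n a p.1 p.2 * gammaKernel (a (n + 1)) (L - p.1)) (Measurable.aemeasurable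
      ((measurable_dirichletWeight_prod n a).mul
        ((measurable_gammaKernel _).comp (measurable_const.sub measurable_fst))))]
    have h3 : ∀ z : ℝ, ∫⁻ x : Fin n → ℝ, dirichletWeight n a z x * gammaKernel (a (n + 1)) (L - z) =
        (∫⁻ x, dirichletWeight n a z x) * gammaKernel (a (n + 1)) (L - z) := fun z =>
      lintegral_mul_const _ (measurable_dirichletWeight n a z)
    simp only [h3]
    -- The induction hypothesis excludes length zero, where the formula can fail; this discards only
    -- a null set of end points `z`.
    have h0 : ∀ᵐ z : ℝ, z ≠ 0 := ae_iff.2 (by simp)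
    rw [lintegral_congr_ae (h0.mono fun z hz => by rw [ih hz]), Finset.sum_range_succ _ (n + 1)]
    rcases lt_or_gt_of_ne hL with h | h
    · have := lintegral_gammaKernel_mul_of_le (a := ∑ k ∈ Finset.range (n + 1), a k)
        (b := a (n + 1)) (A := 0) (B := L) h.le (fun _ => 1)
      simp only [sub_zero, mul_one] at this
      rw [this, gammaKernel_of_neg h]
    · exact lintegral_gammaKernel_conv hS (ha _) h

/-! ### The equilibrium measure: normalization and short intervals. -/

lemma pos_eq_pinnedPos (N : ℕ) (x : Config N) (k : ℕ) :
    pos N x k = pinnedPos (N - 1) N x k := rfl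

lemma measurableSet_Omega (N : ℕ) : MeasurableSet (Omega N) := by
  have : Omega N = ⋂ k : ℕ, ⋂ _ : k < N, {x | pos N x k ≤ pos N x (k + 1)} := by
    ext x; simp [Omega]
  rw [this]
  exact MeasurableSet.iInter fun k => MeasurableSet.iInter fun _ =>
    measurableSet_le (measurable_pos N k) (measurable_pos N (k + 1))

/-- The equilibrium measure as a normalized Dirichlet measure. -/
lemma equilibrium_eq {N : ℕ} (hN : 1 ≤ N) {α : ℝ} (hα : 1 ≤ α) :
    equilibrium N α = volume.withDensity fun x =>
      ENNReal.ofReal (Real.Gamma (N * α) / (N : ℝ) ^ (N * α - 1)) *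
        dirichletWeight (N - 1) (fun _ => α) N x := by
  rw [equilibrium, ← withDensity_indicator (measurableSet_Omega N)]
  congr 1
  funext x
  have hG := Real.Gamma_pos_of_pos (by linarith : 0 < α)
  have hN0 : (0 : ℝ) < N := by exact_mod_cast hN
  have hGN := Real.Gamma_pos_of_pos (mul_pos hN0 (by linarith : 0 < α))
  unfold dirichletWeight
  rw [Nat.sub_add_cancel hN]
  by_cases hx : x ∈ Omega N
  · have h1 : ∀ k ∈ Finset.range N, gammaKernel α
        (pinnedPos (N - 1) N x (k + 1) - pinnedPos (N - 1) N x k) =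
        ENNReal.ofReal ((pos N x (k + 1) - pos N x k) ^ (α - 1) / Real.Gamma α) := fun k hk =>
      gammaKernel_of_nonneg hα (sub_nonneg.2 (hx k (Finset.mem_range.1 hk)))
    have h2 : ∀ k ∈ Finset.range N, 0 ≤ (pos N x (k + 1) - pos N x k) ^ (α - 1) / Real.Gamma α :=
      fun k hk => div_nonneg (Real.rpow_nonneg (sub_nonneg.2 (hx k (Finset.mem_range.1 hk))) _)
        hG.le
    rw [Set.indicator_of_mem hx, Finset.prod_congr rfl h1, ← ENNReal.ofReal_prod_of_nonneg h2,
      ← ENNReal.ofReal_mul (by positivity)]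
    congr 1
    rw [Finset.prod_div_distrib, Finset.prod_const, Finset.card_range]
    field_simp
  · rw [Set.indicator_of_notMem hx]
    obtain ⟨k, hk, hk'⟩ : ∃ k < N, pos N x (k + 1) < pos N x k := by
      simpa [Omega] using hx
    rw [Finset.prod_eq_zero (Finset.mem_range.2 hk), mul_zero]
    exact gammaKernel_of_neg (sub_neg.2 hk')

lemma isProbabilityMeasure_equilibrium {N : ℕ} (hN : 1 ≤ N) {α : ℝ} (hα : 1 ≤ α) :
    IsProbabilityMeasure (equilibrium N α) := by
  constructor
  have hN0 : (0 : ℝ) < N := by exact_mod_cast hN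
  have hGN := Real.Gamma_pos_of_pos (mul_pos hN0 (by linarith : 0 < α))
  rw [equilibrium_eq hN hα, withDensity_apply _ MeasurableSet.univ, setLIntegral_univ,
    lintegral_const_mul _ (measurable_dirichletWeight _ _ _),
    lintegral_dirichletWeight _ (fun _ => by linarith) hN0.ne', Nat.sub_add_cancel hN,
    Finset.sum_const, Finset.card_range, nsmul_eq_mul, gammaKernel_of_pos hN0,
    ← ENNReal.ofReal_mul (by positivity), div_mul_div_comm, mul_comm, div_self (by positivity),
    ENNReal.ofReal_one]

lemma ae_equilibrium (N : ℕ) (α : ℝ) : ∀ᵐ x ∂(equilibrium N α), x ∈ Omega N :=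
  (withDensity_absolutelyContinuous _ _).ae_le (ae_restrict_mem (measurableSet_Omega N))

/-- If the double increment is below `s`, so are both increments at the site, and
`gammaKernel_trunc` bounds the density by `s` times a Dirichlet density of total exponent `N * α -
1`. The ratio of the normalizing constants is `(N * α - 1) / N ≤ α`, so the bound is uniform in `N`.
-/
lemma equilibrium_interval_lt {N : ℕ} (i : Fin (N - 1)) {α : ℝ} (hα : 1 ≤ α) (s : ℝ) :
    equilibrium N α {x | pos N x ((i : ℕ) + 2) - pos N x i < s} ≤
      ENNReal.ofReal (s * (α * (Real.Gamma (α - 1 / 2) / Real.Gamma α) ^ 2)) := by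
  have hi := i.2
  have hN : 2 ≤ N := by omega
  have hN0 : (2 : ℝ) ≤ N := by exact_mod_cast hN
  have hNα : 2 ≤ N * α := by nlinarith
  set r := Real.Gamma (α - 1 / 2) / Real.Gamma α with hr
  have hr0 : 0 < r := div_pos (Real.Gamma_pos_of_pos (by linarith))
    (Real.Gamma_pos_of_pos (by linarith))
  set a : ℕ → ℝ := fun k => if k = i ∨ k = i + 1 then α - 1 / 2 else α with ha
  have ha0 : ∀ k, 0 < a k := fun k => by simp only [ha]; split_ifs <;> linarith
  have hsum : ∑ k ∈ Finset.range N, a k = N * α - 1 := by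
    have : ∀ k, a k = α - ((if k = i then 1 / 2 else 0) + if k = i + 1 then 1 / 2 else 0) := by
      intro k
      simp only [ha]
      split_ifs <;> first | omega | ring
    simp only [this, Finset.sum_sub_distrib, Finset.sum_add_distrib, Finset.sum_ite_eq',
      Finset.sum_const, Finset.card_range, nsmul_eq_mul]
    rw [if_pos (Finset.mem_range.2 (by omega)), if_pos (Finset.mem_range.2 (by omega))]
    ring
  have hmeas : MeasurableSet {x : Config N | pos N x ((i : ℕ) + 2) - pos N x i < s} :=
    measurableSet_lt ((measurable_pos N _).sub (measurable_pos N _)) measurable_const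
  have hGN := Real.Gamma_pos_of_pos (by linarith : 0 < N * α - 1)
  have hGN' : Real.Gamma (N * α) = (N * α - 1) * Real.Gamma (N * α - 1) := by
    rw [← Real.Gamma_add_one (by linarith)]; congr 1; ring
  rcases lt_or_ge s 0 with hs | hs
  · refine le_of_eq_of_le ?_ (zero_le)
    refine measure_mono_null ?_ (ae_equilibrium N α)
    intro x hx hx'
    have h1 := hx' i (by omega)
    have h2 := hx' (i + 1) (by omega)
    replace hx : pos N x (i + 2) - pos N x i < s := hx
    have h3 : pos N x (i + 1 + 1) = pos N x (i + 2) := rfl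
    linarith
  have key : ∀ x ∈ {x : Config N | pos N x ((i : ℕ) + 2) - pos N x i < s},
      dirichletWeight (N - 1) (fun _ => α) N x ≤
        ENNReal.ofReal (s * r ^ 2) * dirichletWeight (N - 1) a N x := by
    intro x hx
    replace hx : pos N x (i + 2) - pos N x i < s := hx
    by_cases hneg : ∃ k < N, pos N x (k + 1) < pos N x k
    · obtain ⟨k, hk, hk'⟩ := hneg
      rw [dirichletWeight, Finset.prod_eq_zero (Finset.mem_range.2 (by omega : k < N - 1 + 1))
        (gammaKernel_of_neg (sub_neg.2 hk'))]
      exact zero_le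
    push Not at hneg
    have h1 := hneg i (by omega)
    have h2 := hneg (i + 1) (by omega)
    have h3 : pos N x (i + 1 + 1) = pos N x (i + 2) := rfl
    set c : ℝ≥0∞ := ENNReal.ofReal (s ^ (1 / 2 : ℝ) * r) with hc
    have hcc : ENNReal.ofReal (s * r ^ 2) = c * c := by
      rw [hc, ← ENNReal.ofReal_mul (by positivity)]
      congr 1
      have : s ^ (1 / 2 : ℝ) * s ^ (1 / 2 : ℝ) = s := by
        rw [← Real.sqrt_eq_rpow, Real.mul_self_sqrt hs]
      nlinarith
    have hprod : c * c = ∏ k ∈ Finset.range (N - 1 + 1),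
        ((if k = i then c else 1) * if k = i + 1 then c else 1) := by
      rw [Finset.prod_mul_distrib, Finset.prod_ite_eq', Finset.prod_ite_eq',
        if_pos (Finset.mem_range.2 (by omega)), if_pos (Finset.mem_range.2 (by omega))]
    rw [hcc, hprod, dirichletWeight, dirichletWeight, ← Finset.prod_mul_distrib]
    refine Finset.prod_le_prod' fun k _ => ?_
    simp only [ha]
    by_cases hk : k = i
    · rw [if_pos hk, if_neg (by omega), if_pos (Or.inl hk), mul_one, hk]
      exact gammaKernel_trunc (by linarith) (show pos N x (i + 1) - pos N x i < s by linarith)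
    · by_cases hk' : k = i + 1
      · rw [if_neg hk, if_pos hk', if_pos (Or.inr hk'), one_mul, hk']
        exact gammaKernel_trunc (by linarith)
          (show pos N x (i + 1 + 1) - pos N x (i + 1) < s by linarith)
      · rw [if_neg hk, if_neg hk', if_neg (by tauto), one_mul, one_mul]
  rw [equilibrium_eq (by omega) hα, withDensity_apply _ hmeas,
    lintegral_const_mul _ (measurable_dirichletWeight _ _ _)]
  calc _ ≤ ENNReal.ofReal (Real.Gamma (N * α) / (N : ℝ) ^ (N * α - 1)) *
        ∫⁻ x, ENNReal.ofReal (s * r ^ 2) * dirichletWeight (N - 1) a N x :=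
        mul_le_mul_right ((setLIntegral_mono' hmeas key).trans (setLIntegral_le_lintegral _ _)) _
    _ = ENNReal.ofReal (s * r ^ 2 * ((N * α - 1) / N)) := by
        rw [lintegral_const_mul _ (measurable_dirichletWeight _ _ _),
          lintegral_dirichletWeight _ ha0 (by positivity), Nat.sub_add_cancel (by omega), hsum,
          gammaKernel_of_pos (by positivity), ← ENNReal.ofReal_mul (by positivity),
          ← ENNReal.ofReal_mul (div_nonneg (by rw [hGN']; nlinarith) (by positivity))]
        congr 1
        rw [hGN', show (N : ℝ) * α - 1 - 1 = (N * α - 1) - 1 by ring,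
          Real.rpow_sub_one (by positivity : (N : ℝ) ≠ 0) (N * α - 1)]
        have : 0 < (N : ℝ) ^ (N * α - 1) := by positivity
        field_simp
    _ ≤ _ := by
        refine ENNReal.ofReal_le_ofReal ?_
        have : (N * α - 1) / N ≤ α := by
          rw [div_le_iff₀ (by positivity)]; linarith
        calc _ ≤ s * r ^ 2 * α := by gcongr
          _ = _ := by ring

/-! ### The averaged one-step operator and its invariant measure. -/

lemma pos_update_self {N : ℕ} (x : Config N) (i : Fin (N - 1)) (z : ℝ) :
    pos N (Function.update x i z) (i + 1) = z := by
  simp [pos]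

lemma pos_update_of_ne {N : ℕ} (x : Config N) (i : Fin (N - 1)) (z : ℝ) {k : ℕ}
    (hk : k ≠ i + 1) : pos N (Function.update x i z) k = pos N x k := by
  unfold pos
  split_ifs with h0 h1
  · rfl
  · exact Function.update_of_ne (fun h => hk (by rw [← h]; simp; omega)) _ _
  · rfl

noncomputable section

/-- The expectation of `g` after resampling at the site `i`. -/
def siteAverage (N : ℕ) (α : ℝ) (i : Fin (N - 1)) (g : Config N → ℝ≥0∞) (x : Config N) : ℝ≥0∞ :=
  ∫⁻ u, g (resample N i u x) ∂(betaMeasure α α)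

/-- The expectation of `g` after resampling at a uniformly chosen site. -/
def average (N : ℕ) (α : ℝ) (g : Config N → ℝ≥0∞) (x : Config N) : ℝ≥0∞ :=
  ((N - 1 : ℕ) : ℝ≥0∞)⁻¹ * ∑ i, siteAverage N α i g x

end

lemma measurable_siteAverage {N : ℕ} (α : ℝ) (i : Fin (N - 1)) {g : Config N → ℝ≥0∞}
    (hg : Measurable g) : Measurable (siteAverage N α i g) :=
  (hg.comp (measurable_resample N i)).lintegral_prod_right'

lemma measurable_average {N : ℕ} (α : ℝ) {g : Config N → ℝ≥0∞} (hg : Measurable g) :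
    Measurable (average N α g) :=
  (Finset.measurable_fun_sum _ fun i _ => measurable_siteAverage α i hg).const_mul _

lemma dirichletWeight_update {N : ℕ} (a : ℕ → ℝ) (i : Fin (N - 1)) (x : Config N) (z : ℝ) :
    dirichletWeight (N - 1) a N (Function.update x i z) =
      (∏ k ∈ ((Finset.range (N - 1 + 1)).erase i).erase (i + 1),
        gammaKernel (a k) (pos N x (k + 1) - pos N x k)) *
      (gammaKernel (a i) (z - pos N x i) * gammaKernel (a (i + 1)) (pos N x (i + 2) - z)) := by
  have hi := i.2
  rw [dirichletWeight, ← Finset.mul_prod_erase _ _ (Finset.mem_range.2 (by omega : (i : ℕ) < _)),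
    ← Finset.mul_prod_erase _ _ (Finset.mem_erase.2 ⟨(by omega : (i : ℕ) + 1 ≠ i),
      Finset.mem_range.2 (by omega : (i : ℕ) + 1 < _)⟩), ← mul_assoc, mul_comm]
  simp only [← pos_eq_pinnedPos, pos_update_self]
  rw [pos_update_of_ne x i z (by omega : (i : ℕ) ≠ i + 1),
    pos_update_of_ne x i z (by omega : (i : ℕ) + 1 + 1 ≠ i + 1)]
  congr 1
  refine Finset.prod_congr rfl fun k hk => ?_
  simp only [Finset.mem_erase] at hk
  rw [pos_update_of_ne x i z (by omega), pos_update_of_ne x i z (by omega)]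

lemma resample_update {N : ℕ} (i : Fin (N - 1)) (u z : ℝ) (x : Config N) :
    resample N i u (Function.update x i z) = resample N i u x := by
  rw [resample, resample, pos_update_of_ne _ _ _ (by omega), pos_update_of_ne _ _ _ (by omega),
    Function.update_idem]

/-- The equilibrium measure is invariant under resampling at each site. -/
lemma lintegral_siteAverage_equilibrium {N : ℕ} {α : ℝ} (hα : 1 ≤ α) (i : Fin (N - 1))
    {g : Config N → ℝ≥0∞} (hg : Measurable g) :
    ∫⁻ x, siteAverage N α i g x ∂(equilibrium N α) = ∫⁻ x, g x ∂(equilibrium N α) := by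
  have hi := i.2
  have hα0 : 0 < α := by linarith
  have hω := measurable_dirichletWeight (N - 1) (fun _ => α) N
  have hA := measurable_siteAverage α i hg
  rw [equilibrium_eq (by omega) hα,
    lintegral_withDensity_eq_lintegral_mul _ (hω.const_mul _) hA,
    lintegral_withDensity_eq_lintegral_mul _ (hω.const_mul _) hg]
  -- It suffices to integrate out the coordinate `i`. The weight is a product of gamma kernels, only
  -- two of which see this coordinate, and their normalized product is exactly the resampling law.
  refine lintegral_eq_of_lmarginal_eq {i} ((hω.const_mul _).mul hA) ((hω.const_mul _).mul hg) ?_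
  rw [lmarginal_singleton, lmarginal_singleton]
  funext x
  have := isProbabilityMeasureBeta hα0 hα0
  have hGm : Measurable fun z : ℝ => g (Function.update x i z) :=
    hg.comp (measurable_update x)
  have hS : ∀ z, siteAverage N α i g (Function.update x i z) = siteAverage N α i g x := by
    intro z; simp only [siteAverage, resample_update]
  simp only [Pi.mul_apply, hS, dirichletWeight_update, mul_assoc]
  set R := ∏ k ∈ ((Finset.range (N - 1 + 1)).erase i).erase (i + 1),
    gammaKernel α (pos N x (k + 1) - pos N x k)
  have hmk : Measurable fun z : ℝ =>
      gammaKernel α (z - pos N x i) * gammaKernel α (pos N x (i + 2) - z) :=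
    ((measurable_gammaKernel α).comp (measurable_id.sub_const _)).mul
      ((measurable_gammaKernel α).comp (measurable_const.sub measurable_id))
  have hm1 : Measurable fun z : ℝ => gammaKernel α (z - pos N x i) *
      (gammaKernel α (pos N x (i + 2) - z) * siteAverage N α i g x) := by
    simpa only [mul_assoc] using hmk.mul_const (siteAverage N α i g x)
  have hm2 : Measurable fun z : ℝ => gammaKernel α (z - pos N x i) *
      (gammaKernel α (pos N x (i + 2) - z) * g (Function.update x i z)) := by
    simp only [← mul_assoc]
    exact hmk.mul hGm
  rw [lintegral_const_mul _ (hm1.const_mul _), lintegral_const_mul _ hm1,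
    lintegral_const_mul _ (hm2.const_mul _), lintegral_const_mul _ hm2]
  congr 2
  simp only [← mul_assoc]
  rcases lt_or_ge (pos N x i) (pos N x (i + 2)) with h | h
  · rw [lintegral_gammaKernel_mul hα0 hα0 h measurable_const,
      lintegral_gammaKernel_mul hα0 hα0 h hGm, lintegral_const, measure_univ, mul_one]
    rfl
  · rw [lintegral_gammaKernel_mul_of_le h (fun _ => siteAverage N α i g x),
      lintegral_gammaKernel_mul_of_le h (fun z => g (Function.update x i z))]

lemma lintegral_average_equilibrium {N : ℕ} (hN : 2 ≤ N) {α : ℝ} (hα : 1 ≤ α)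
    {g : Config N → ℝ≥0∞} (hg : Measurable g) :
    ∫⁻ x, average N α g x ∂(equilibrium N α) = ∫⁻ x, g x ∂(equilibrium N α) := by
  unfold average
  have h0 : ((N - 1 : ℕ) : ℝ≥0∞) ≠ 0 := by
    rw [Nat.cast_ne_zero]; omega
  rw [lintegral_const_mul _ (Finset.measurable_fun_sum _ fun i _ => measurable_siteAverage α i hg),
    lintegral_finsetSum _ fun i _ => measurable_siteAverage α i hg]
  simp only [lintegral_siteAverage_equilibrium hα _ hg, Finset.sum_const, Finset.card_univ,
    Fintype.card_fin, nsmul_eq_mul]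
  rw [← mul_assoc, ENNReal.inv_mul_cancel h0 (ENNReal.natCast_ne_top _), one_mul]

lemma measurable_iterate_average {N : ℕ} (α : ℝ) {g : Config N → ℝ≥0∞} (hg : Measurable g)
    (n : ℕ) : Measurable ((average N α)^[n] g) := by
  induction n with
  | zero => exact hg
  | succ n ih => rw [Function.iterate_succ_apply']; exact measurable_average α ih

lemma lintegral_iterate_average_equilibrium {N : ℕ} (hN : 2 ≤ N) {α : ℝ} (hα : 1 ≤ α)
    {g : Config N → ℝ≥0∞} (hg : Measurable g) (n : ℕ) :
    ∫⁻ x, (average N α)^[n] g x ∂(equilibrium N α) = ∫⁻ x, g x ∂(equilibrium N α) := by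
  induction n with
  | zero => rfl
  | succ n ih =>
    rw [Function.iterate_succ_apply',
      lintegral_average_equilibrium hN hα (measurable_iterate_average α hg n), ih]

lemma average_mono {N : ℕ} (α : ℝ) {g h : Config N → ℝ≥0∞} (hgh : g ≤ h) :
    average N α g ≤ average N α h := fun _ =>
  mul_le_mul_right (Finset.sum_le_sum fun _ _ => lintegral_mono fun _ => hgh _) _

lemma average_const {N : ℕ} (hN : 2 ≤ N) {α : ℝ} (hα : 0 < α) (c : ℝ≥0∞) :
    average N α (fun _ => c) = fun _ => c := by
  funext x
  have := isProbabilityMeasureBeta hα hα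
  have h0 : ((N - 1 : ℕ) : ℝ≥0∞) ≠ 0 := by
    rw [Nat.cast_ne_zero]; omega
  simp only [average, siteAverage, lintegral_const, measure_univ, mul_one, Finset.sum_const,
    Finset.card_univ, Fintype.card_fin, nsmul_eq_mul]
  rw [← mul_assoc, ENNReal.inv_mul_cancel h0 (ENNReal.natCast_ne_top _), one_mul]

lemma iterate_average_le_one {N : ℕ} (hN : 2 ≤ N) {α : ℝ} (hα : 0 < α) {g : Config N → ℝ≥0∞}
    (hg : ∀ x, g x ≤ 1) (n : ℕ) (x : Config N) : (average N α)^[n] g x ≤ 1 := by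
  induction n generalizing x with
  | zero => exact hg x
  | succ n ih =>
    rw [Function.iterate_succ_apply']
    exact (average_mono α (fun y => ih y) x).trans_eq (congrFun (average_const hN hα 1) x)

/-- The `n`-step update kernel acts on functions as the `n`-th power of `(N - 1) • average`. -/
lemma lintegral_updates {N : ℕ} (hN : 2 ≤ N) {α : ℝ} (n : ℕ) {g : Config N → ℝ≥0∞}
    (hg : Measurable g) (x : Config N) :
    ∫⁻ y, g y ∂(updates N α n x) = ((N - 1 : ℕ) : ℝ≥0∞) ^ n * (average N α)^[n] g x := by
  have h0 : ((N - 1 : ℕ) : ℝ≥0∞) ≠ 0 := by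
    rw [Nat.cast_ne_zero]; omega
  induction n generalizing g with
  | zero => simp [updates, Kernel.id_apply, lintegral_dirac' _ hg]
  | succ n ih =>
    rw [updates, Kernel.lintegral_comp _ _ _ hg]
    have h : ∀ y, ∫⁻ z, g z ∂((∑ i, siteKernel N α i) y) =
        ((N - 1 : ℕ) : ℝ≥0∞) * average N α g y := by
      intro y
      rw [average, ← mul_assoc, ENNReal.mul_inv_cancel h0 (ENNReal.natCast_ne_top _), one_mul,
        show (∑ i, siteKernel N α i) y = ∑ i, siteKernel N α i y by simp,
          lintegral_finsetSum_measure]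
      refine Finset.sum_congr rfl fun i _ => ?_
      rw [siteKernel_apply, lintegral_map hg (measurable_resample_right N i y)]
      rfl
    simp only [h]
    rw [lintegral_const_mul _ (measurable_average α hg), ih (measurable_average α hg),
      Function.iterate_succ_apply, ← mul_assoc, pow_succ, mul_comm (_ ^ n)]

/-! ### Contraction of the sine-weighted distance. -/

lemma update_mem_Omega {N : ℕ} {x : Config N} (hx : x ∈ Omega N) (i : Fin (N - 1)) {z : ℝ}
    (h1 : pos N x i ≤ z) (h2 : z ≤ pos N x (i + 2)) : Function.update x i z ∈ Omega N := by
  intro k hk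
  by_cases hk1 : k = i
  · rw [hk1, pos_update_self, pos_update_of_ne _ _ _ (by omega)]
    exact h1
  · by_cases hk2 : k = i + 1
    · rw [hk2, pos_update_self, pos_update_of_ne _ _ _ (by omega)]
      exact h2
    · rw [pos_update_of_ne _ _ _ hk2, pos_update_of_ne _ _ _ (by omega)]
      exact hx k hk

lemma pos_le_pos_add_two {N : ℕ} {x : Config N} (hx : x ∈ Omega N) (i : Fin (N - 1)) :
    pos N x i ≤ pos N x (i + 2) :=
  (hx i (by have := i.2; omega)).trans (hx (i + 1) (by have := i.2; omega))

lemma resample_mem_Omega {N : ℕ} {x : Config N} (hx : x ∈ Omega N) (i : Fin (N - 1)) {u : ℝ}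
    (h0 : 0 ≤ u) (h1 : u ≤ 1) : resample N i u x ∈ Omega N := by
  have := pos_le_pos_add_two hx i
  exact update_mem_Omega hx i (by nlinarith) (by nlinarith)

lemma pos_zero (N : ℕ) (x : Config N) : pos N x 0 = 0 := by simp [pos]

lemma pos_last {N : ℕ} (hN : 1 ≤ N) (x : Config N) : pos N x N = N := by
  simp only [pos, lt_irrefl, dite_false]
  rw [if_neg (by omega)]

lemma pos_mono {N : ℕ} {x : Config N} (hx : x ∈ Omega N) {j k : ℕ} (hjk : j ≤ k) (hk : k ≤ N) :
    pos N x j ≤ pos N x k := by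
  induction k, hjk using Nat.le_induction with
  | base => exact le_rfl
  | succ k hjk ih => exact (ih (by omega)).trans (hx k (by omega))

lemma pos_mem_Icc {N : ℕ} (hN : 1 ≤ N) {x : Config N} (hx : x ∈ Omega N) {k : ℕ} (hk : k ≤ N) :
    0 ≤ pos N x k ∧ pos N x k ≤ N := by
  have h1 := pos_mono hx (Nat.zero_le k) hk
  have h2 := pos_mono hx hk le_rfl
  rw [pos_zero] at h1
  rw [pos_last hN] at h2
  exact ⟨h1, h2⟩

noncomputable section

/-- The weighted `ℓ¹` distance of two configurations. -/
def weightedDist (N : ℕ) (w : ℕ → ℝ) (x y : Config N) : ℝ :=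
  ∑ k ∈ Finset.range (N + 1), w k * |pos N x k - pos N y k|

end

lemma weightedDist_nonneg {N : ℕ} {w : ℕ → ℝ} (hw : ∀ k ≤ N, 0 ≤ w k) (x y : Config N) :
    0 ≤ weightedDist N w x y :=
  Finset.sum_nonneg fun k hk =>
    mul_nonneg (hw k (by have := Finset.mem_range.1 hk; omega)) (abs_nonneg _)

lemma weightedDist_update {N : ℕ} (w : ℕ → ℝ) (x y : Config N) (i : Fin (N - 1)) (z z' : ℝ) :
    weightedDist N w (Function.update x i z) (Function.update y i z') =
      weightedDist N w x y - w (i + 1) * |pos N x (i + 1) - pos N y (i + 1)| +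
        w (i + 1) * |z - z'| := by
  have hi : (i : ℕ) + 1 ∈ Finset.range (N + 1) := Finset.mem_range.2 (by have := i.2; omega)
  rw [weightedDist, weightedDist, ← Finset.add_sum_erase _ _ hi, ← Finset.add_sum_erase _ _ hi,
    pos_update_self, pos_update_self]
  have : ∀ k ∈ (Finset.range (N + 1)).erase (i + 1),
      w k * |pos N (Function.update x i z) k - pos N (Function.update y i z') k| =
      w k * |pos N x k - pos N y k| := fun k hk => by
    rw [pos_update_of_ne _ _ _ (Finset.ne_of_mem_erase hk),
      pos_update_of_ne _ _ _ (Finset.ne_of_mem_erase hk)]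
  rw [Finset.sum_congr rfl this]
  ring

/-- Symmetry of the Dirichlet Laplacian: the difference of the two sides telescopes, and the
boundary values vanish. It moves the neighbour average from the distances to the weights, where the
eigenvalue relation applies. -/
lemma sum_mul_neighbours {w δ : ℕ → ℝ} {d : ℕ} (hw0 : w 0 = 0) (hw : w (d + 1) = 0)
    (hδ0 : δ 0 = 0) (hδ : δ (d + 1) = 0) :
    ∑ i ∈ Finset.range d, w (i + 1) * (δ i + δ (i + 2)) =
      ∑ i ∈ Finset.range d, δ (i + 1) * (w i + w (i + 2)) := by
  have h := Finset.sum_range_sub' (fun i => w (i + 1) * δ i - w i * δ (i + 1)) d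
  simp only [hw0, hw, hδ0, hδ] at h
  rw [← sub_eq_zero, ← Finset.sum_sub_distrib]
  rw [show (0 : ℝ) = w (0 + 1) * 0 - 0 * δ (0 + 1) - (0 * δ d - w d * 0) by ring, ← h]
  exact Finset.sum_congr rfl fun i _ => by ring

lemma weightedDist_eq_sum {N : ℕ} (hN : 1 ≤ N) (w : ℕ → ℝ) (x y : Config N) :
    weightedDist N w x y =
      ∑ i : Fin (N - 1), w (i + 1) * |pos N x (i + 1) - pos N y (i + 1)| := by
  rw [Fin.sum_univ_eq_sum_range (fun i => w (i + 1) * |pos N x (i + 1) - pos N y (i + 1)|),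
    weightedDist, Finset.sum_range_succ, pos_last hN, pos_last hN]
  obtain ⟨d, rfl⟩ : ∃ d, N = d + 1 := ⟨N - 1, by omega⟩
  rw [Finset.sum_range_succ', pos_zero, pos_zero]
  simp

noncomputable section

/-- The first Dirichlet eigenfunction of the discrete Laplacian on `{0, …, N}`. -/
def sineWeight (N k : ℕ) : ℝ := Real.sin (k * (Real.pi / N))

end

lemma sineWeight_nonneg {N k : ℕ} (hk : k ≤ N) : 0 ≤ sineWeight N k := by
  have hk' : (k : ℝ) ≤ N := by exact_mod_cast hk
  refine Real.sin_nonneg_of_nonneg_of_le_pi (by positivity) ?_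
  rw [← mul_div_assoc]
  refine div_le_of_le_mul₀ (Nat.cast_nonneg _) Real.pi_pos.le ?_
  nlinarith [Real.pi_pos]

lemma sineWeight_le_one (N k : ℕ) : sineWeight N k ≤ 1 := Real.sin_le_one _

lemma sineWeight_add (N k : ℕ) :
    sineWeight N k + sineWeight N (k + 2) = 2 * Real.cos (Real.pi / N) * sineWeight N (k + 1) := by
  unfold sineWeight
  push_cast
  rw [show (k : ℝ) * (Real.pi / N) = (k + 1) * (Real.pi / N) - Real.pi / N by ring,
    show ((k : ℝ) + 2) * (Real.pi / N) = (k + 1) * (Real.pi / N) + Real.pi / N by ring,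
    Real.sin_sub, Real.sin_add]
  ring

lemma sum_weightedDist_neighbours {N : ℕ} (hN : 1 ≤ N) (x y : Config N) :
    ∑ i : Fin (N - 1), (weightedDist N (sineWeight N) x y -
        sineWeight N (i + 1) * |pos N x (i + 1) - pos N y (i + 1)| +
        sineWeight N (i + 1) *
          ((|pos N x i - pos N y i| + |pos N x (i + 2) - pos N y (i + 2)|) / 2)) =
      (((N - 1 : ℕ) : ℝ) - gap N) * weightedDist N (sineWeight N) x y := by
  have hN0 : (N : ℝ) ≠ 0 := by positivity
  have h := sum_mul_neighbours (w := sineWeight N) (δ := fun k => |pos N x k - pos N y k|)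
    (d := N - 1) (by simp [sineWeight])
    (by rw [Nat.sub_add_cancel hN]; simp [sineWeight, mul_div_cancel₀ _ hN0])
    (by simp [pos_zero]) (by simp [Nat.sub_add_cancel hN, pos_last hN])
  have h2 : ∑ i : Fin (N - 1), sineWeight N (i + 1) *
      ((|pos N x i - pos N y i| + |pos N x (i + 2) - pos N y (i + 2)|) / 2) =
      Real.cos (Real.pi / N) * weightedDist N (sineWeight N) x y := by
    rw [Fin.sum_univ_eq_sum_range (fun i => sineWeight N (i + 1) *
      ((|pos N x i - pos N y i| + |pos N x (i + 2) - pos N y (i + 2)|) / 2)),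
      weightedDist_eq_sum hN, Fin.sum_univ_eq_sum_range (fun i => sineWeight N (i + 1) *
        |pos N x (i + 1) - pos N y (i + 1)|), Finset.mul_sum]
    simp only [sineWeight_add] at h
    have h3 : ∀ i, sineWeight N (i + 1) *
      ((|pos N x i - pos N y i| + |pos N x (i + 2) - pos N y (i + 2)|) / 2) =
      (sineWeight N (i + 1) *
      (|pos N x i - pos N y i| + |pos N x (i + 2) - pos N y (i + 2)|)) / 2 := fun i => by ring
    simp only [h3]
    rw [← Finset.sum_div, h, Finset.sum_div]
    exact Finset.sum_congr rfl fun i _ => by ring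
  rw [Finset.sum_add_distrib, h2, Finset.sum_sub_distrib, ← weightedDist_eq_sum hN,
    Finset.sum_const, Finset.card_univ, Fintype.card_fin, nsmul_eq_mul, gap]
  ring

lemma gap_nonneg (N : ℕ) : 0 ≤ gap N := sub_nonneg.2 (Real.cos_le_one _)

/-- One step of the synchronous coupling contracts the sine-weighted distance. -/
lemma average_contraction {N : ℕ} (hN : 2 ≤ N) {α : ℝ} (hα : 0 < α) {g H : Config N → ℝ≥0∞}
    (hg : Measurable g) {e : ℝ≥0∞} {x y : Config N} (hx : x ∈ Omega N) (hy : y ∈ Omega N)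
    (h : ∀ x ∈ Omega N, ∀ y ∈ Omega N,
      g x ≤ g y + e * ENNReal.ofReal (weightedDist N (sineWeight N) x y) + H y) :
    average N α g x ≤ average N α g y +
      e * ENNReal.ofReal ((1 - gap N / ((N - 1 : ℕ) : ℝ)) * weightedDist N (sineWeight N) x y) +
      average N α H y := by
  have hβ := isProbabilityMeasureBeta hα hα
  set δ : ℕ → ℝ := fun k => |pos N x k - pos N y k| with hδ
  set R : Fin (N - 1) → ℝ := fun i => weightedDist N (sineWeight N) x y -
    sineWeight N (i + 1) * δ (i + 1) with hR
  have hR0 : ∀ i, 0 ≤ R i := by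
    intro i
    have h1 := weightedDist_update (sineWeight N) x y i 0 0
    have h2 := weightedDist_nonneg (fun k hk => sineWeight_nonneg hk)
      (Function.update x i 0) (Function.update y i 0)
    rw [h1] at h2
    simpa [hR] using h2
  have hw : ∀ i : Fin (N - 1), 0 ≤ sineWeight N (i + 1) := fun i =>
    sineWeight_nonneg (by have := i.2; omega)
  have hδ0 : ∀ k, 0 ≤ δ k := fun k => abs_nonneg _
  have site : ∀ i, siteAverage N α i g x ≤ siteAverage N α i g y +
      e * ENNReal.ofReal (R i + sineWeight N (i + 1) * ((δ i + δ (i + 2)) / 2)) +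
      siteAverage N α i H y := by
    intro i
    -- Both configurations are resampled with the same `u`, so the new displacement is at most the
    -- same convex combination of the neighbouring displacements; its mean is their half-sum.
    have step : ∀ᵐ u ∂(betaMeasure α α), g (resample N i u x) ≤ g (resample N i u y) +
        e * (ENNReal.ofReal (R i) + ENNReal.ofReal (sineWeight N (i + 1)) *
          ENNReal.ofReal (u * δ i + (1 - u) * δ (i + 2))) + H (resample N i u y) := by
      filter_upwards [ae_betaMeasure α α] with u hu
      have h1u : 0 ≤ 1 - u := by linarith [hu.2]
      refine (h _ (resample_mem_Omega hx i hu.1.le hu.2.le) _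
        (resample_mem_Omega hy i hu.1.le hu.2.le)).trans ?_
      rw [← ENNReal.ofReal_mul (hw i), ← ENNReal.ofReal_add (hR0 i) (mul_nonneg (hw i)
        (add_nonneg (mul_nonneg hu.1.le (hδ0 _)) (mul_nonneg h1u (hδ0 _))))]
      gcongr
      rw [resample, resample, weightedDist_update]
      refine add_le_add_right (mul_le_mul_of_nonneg_left ?_ (hw i)) _
      calc _ = |u * (pos N x i - pos N y i) + (1 - u) * (pos N x (i + 2) - pos N y (i + 2))| := by
            congr 1; ring
        _ ≤ _ := by
            refine (abs_add_le _ _).trans ?_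
            rw [abs_mul, abs_mul, abs_of_pos hu.1, abs_of_nonneg h1u]
    refine (lintegral_mono_ae step).trans ?_
    have hm1 : Measurable fun u => g (resample N i u y) := hg.comp (measurable_resample_right N i y)
    have hm2 : Measurable fun u => g (resample N i u y) +
        e * (ENNReal.ofReal (R i) + ENNReal.ofReal (sineWeight N (i + 1)) *
          ENNReal.ofReal (u * δ i + (1 - u) * δ (i + 2))) := hm1.add (by fun_prop)
    rw [lintegral_add_left hm2, lintegral_add_left hm1,
      lintegral_const_mul _ (by fun_prop), lintegral_add_left measurable_const,
      lintegral_const_mul _ (by fun_prop), lintegral_betaMeasure_convex hα (hδ0 _) (hδ0 _),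
      lintegral_const, measure_univ, mul_one, ← ENNReal.ofReal_mul (hw i),
      ← ENNReal.ofReal_add (hR0 i) (mul_nonneg (hw i) (div_nonneg (add_nonneg (hδ0 _) (hδ0 _))
        two_pos.le))]
    rfl
  have hd : (0 : ℝ) < ((N - 1 : ℕ) : ℝ) := by
    have : 0 < N - 1 := by omega
    exact_mod_cast this
  unfold average
  refine (mul_le_mul_right (Finset.sum_le_sum fun i _ => site i) _).trans_eq ?_
  rw [Finset.sum_add_distrib, Finset.sum_add_distrib, mul_add, mul_add, ← Finset.mul_sum,
    ← ENNReal.ofReal_sum_of_nonneg fun i _ => add_nonneg (hR0 i)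
      (mul_nonneg (hw i) (div_nonneg (add_nonneg (hδ0 _) (hδ0 _)) two_pos.le)),
    sum_weightedDist_neighbours (by omega)]
  congr 2
  rw [mul_left_comm]
  congr 1
  rw [← ENNReal.ofReal_natCast, ← ENNReal.ofReal_inv_of_pos hd,
    ← ENNReal.ofReal_mul (by positivity)]
  congr 1
  field_simp

lemma iterate_average_contraction {N : ℕ} (hN : 2 ≤ N) {α : ℝ} (hα : 0 < α)
    {g H : Config N → ℝ≥0∞} (hg : Measurable g) {e : ℝ≥0∞}
    (hρ : 0 ≤ 1 - gap N / ((N - 1 : ℕ) : ℝ))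
    (h : ∀ x ∈ Omega N, ∀ y ∈ Omega N,
      g x ≤ g y + e * ENNReal.ofReal (weightedDist N (sineWeight N) x y) + H y) (n : ℕ) :
    ∀ x ∈ Omega N, ∀ y ∈ Omega N,
      (average N α)^[n] g x ≤ (average N α)^[n] g y +
        e * ENNReal.ofReal ((1 - gap N / ((N - 1 : ℕ) : ℝ)) ^ n) *
          ENNReal.ofReal (weightedDist N (sineWeight N) x y) + (average N α)^[n] H y := by
  induction n with
  | zero => simpa using h
  | succ n ih =>
    intro x hx y hy
    simp only [Function.iterate_succ_apply']
    refine (average_contraction hN hα (measurable_iterate_average α hg n) hx hy ih).trans_eq ?_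
    rw [ENNReal.ofReal_mul hρ, pow_succ, ENNReal.ofReal_mul (by positivity)]
    ring

/-! ### Merging two configurations at one site. -/

/-- The Beta law on `[a, b]` dominates a multiple of the Beta law on each subinterval `[A, B]`. -/
lemma betaMeasure_minorization_interval {α : ℝ} (hα : 1 ≤ α) {a b A B : ℝ} (ha : a ≤ A)
    (hAB : A < B) (hb : B ≤ b) {F : ℝ → ℝ≥0∞} (hF : Measurable F) :
    ENNReal.ofReal (((B - A) / (b - a)) ^ (2 * α - 1)) *
        ∫⁻ u, F (u * A + (1 - u) * B) ∂(betaMeasure α α) ≤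
      ∫⁻ u, F (u * a + (1 - u) * b) ∂(betaMeasure α α) := by
  have hab : 0 < b - a := by linarith
  refine le_of_eq_of_le ?_ (betaMeasure_minorization hα (p := (b - B) / (b - a))
    (q := (B - A) / (b - a)) (div_nonneg (by linarith) hab.le) (div_pos (by linarith) hab)
    (by rw [← add_div, div_le_one hab]; linarith) (G := fun u => F (u * a + (1 - u) * b))
    (by fun_prop))
  congr 1
  refine lintegral_congr fun u => ?_
  congr 1
  field_simp
  ring

/-- If `X`, `Y` are the integrals of a function bounded by one against two probability measures,
the first of which dominates `l` times the second, then `X ≤ l Y + (1 - l)`. -/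
lemma le_mul_add_of_minorization {X X' Y Y' l r : ℝ≥0∞} (hX : X + X' = 1) (hY : Y + Y' = 1)
    (h : l * Y' ≤ X') (hr : 1 ≤ l + r) : X ≤ l * Y + r := by
  have hfin : l * Y' ≠ ∞ := by
    refine ne_top_of_le_ne_top ENNReal.one_ne_top (h.trans ?_)
    rw [← hX]; exact le_add_self
  refine (ENNReal.add_le_add_iff_right hfin).1 ?_
  calc X + l * Y' ≤ X + X' := by gcongr
    _ ≤ l + r := hX.trans_le hr
    _ = l * (Y + Y') + r := by rw [hY, mul_one]
    _ = _ := by ring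

lemma lintegral_add_one_sub {Ω : Type*} [MeasurableSpace Ω] (μ : Measure Ω) [IsProbabilityMeasure μ]
    {F : Ω → ℝ≥0∞} (hF : Measurable F) (h1 : ∀ u, F u ≤ 1) :
    ∫⁻ u, F u ∂μ + ∫⁻ u, (1 - F u) ∂μ = 1 := by
  rw [← lintegral_add_left hF]
  simp [add_tsub_cancel_of_le (h1 _)]

lemma one_le_rpow_add {p t : ℝ} (hp : 1 ≤ p) (ht : t ≤ 1) : 1 ≤ (1 - t) ^ p + p * t := by
  have := one_add_mul_self_le_rpow_one_add (s := -t) (by linarith) hp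
  rw [show (1 : ℝ) + -t = 1 - t by ring] at this
  linarith

noncomputable section

/-- The number of sites other than `i` at which two configurations differ. -/
def hammingDistOff {N : ℕ} (i : Fin (N - 1)) (x y : Config N) : ℕ :=
  (Finset.univ.filter fun j => j ≠ i ∧ x j ≠ y j).card

/-- The sum of the distances of two configurations at the two neighbours of the site `i`. -/
def neighbourDist {N : ℕ} (i : Fin (N - 1)) (x y : Config N) : ℝ :=
  |pos N x i - pos N y i| + |pos N x (i + 2) - pos N y (i + 2)|

/-- The indicator of the event that the neighbours of the site `i` are at distance less
than `s`. -/
def shortInterval {N : ℕ} (s : ℝ) (i : Fin (N - 1)) (y : Config N) : ℝ≥0∞ :=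
  Set.indicator {y : Config N | pos N y ((i : ℕ) + 2) - pos N y i < s} 1 y

end

lemma neighbourDist_nonneg {N : ℕ} (i : Fin (N - 1)) (x y : Config N) : 0 ≤ neighbourDist i x y :=
  add_nonneg (abs_nonneg _) (abs_nonneg _)

lemma hammingDist_update {N : ℕ} (i : Fin (N - 1)) (x y : Config N) (z : ℝ) :
    hammingDist (Function.update x i z) (Function.update y i z) = hammingDistOff i x y := by
  unfold hammingDist hammingDistOff
  congr 1
  ext j
  by_cases h : j = i
  · subst h; simp
  · simp [h]

/-- Each differing site is omitted exactly once. Merging at a uniform site therefore multiplies the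
mean Hamming distance by `1 - 1 / (N - 1)`. -/
lemma sum_hammingDistOff {N : ℕ} (x y : Config N) :
    ∑ i : Fin (N - 1), hammingDistOff i x y + hammingDist x y = (N - 1) * hammingDist x y := by
  have h : ∀ i : Fin (N - 1), hammingDistOff i x y + (if x i ≠ y i then 1 else 0) =
      hammingDist x y := by
    intro i
    unfold hammingDistOff hammingDist
    split_ifs with hi
    · have : i ∈ Finset.univ.filter fun j => x j ≠ y j := by simpa using hi
      rw [← Finset.card_erase_add_one this]
      congr 2
      ext j; simp
    · rw [add_zero]
      congr 1
      ext j
      simp only [Finset.mem_filter, Finset.mem_univ, true_and, and_iff_right_iff_imp]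
      rintro hj rfl
      exact hi hj
  have h2 : hammingDist x y = ∑ i : Fin (N - 1), if x i ≠ y i then 1 else 0 := by
    rw [hammingDist, Finset.card_filter]
  conv_lhs => rw [h2]
  rw [← Finset.sum_add_distrib, Finset.sum_congr rfl fun i _ => h i]
  simp

lemma sum_neighbourDist_le {N : ℕ} (hN : 2 ≤ N) (x y : Config N) :
    ∑ i : Fin (N - 1), neighbourDist i x y ≤ 2 * weightedDist N (fun _ => 1) x y := by
  have h0 : ∀ k, 0 ≤ |pos N x k - pos N y k| := fun k => abs_nonneg _
  unfold neighbourDist weightedDist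
  rw [Finset.sum_add_distrib, two_mul,
    Fin.sum_univ_eq_sum_range (fun i => |pos N x i - pos N y i|),
    Fin.sum_univ_eq_sum_range (fun i => |pos N x (i + 2) - pos N y (i + 2)|)]
  simp only [one_mul]
  refine add_le_add (Finset.sum_le_sum_of_subset_of_nonneg (fun k hk => ?_) fun k _ _ => h0 k) ?_
  · simp only [Finset.mem_range] at hk ⊢; omega
  · obtain ⟨d, rfl⟩ : ∃ d, N = d + 2 := ⟨N - 2, by omega⟩
    rw [Finset.sum_range_succ', Finset.sum_range_succ']
    have : d + 2 - 1 = d + 1 := by omega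
    rw [this]
    have h1 := h0 0
    have h2 := h0 (0 + 1)
    have h3 : ∀ k, k + 1 + 1 = k + 2 := fun k => rfl
    simp only [h3]
    linarith

/-- One step, at the site `i`, of the coupling which tries to make the two configurations agree
at the updated site. -/
lemma siteAverage_coupling {N : ℕ} {α : ℝ} (hα : 1 ≤ α) {g H : Config N → ℝ≥0∞}
    (hg : Measurable g) (hg1 : ∀ x, g x ≤ 1) (hH : Measurable H) {c e : ℝ≥0∞} {s : ℝ} (hs : 0 < s)
    (h : ∀ x ∈ Omega N, ∀ y ∈ Omega N, g x ≤ g y + c * (hammingDist x y : ℝ≥0∞) +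
      e * ENNReal.ofReal (weightedDist N (fun _ => 1) x y) + H y)
    {x y : Config N} (hx : x ∈ Omega N) (hy : y ∈ Omega N) (i : Fin (N - 1)) :
    siteAverage N α i g x ≤ siteAverage N α i g y + c * (hammingDistOff i x y : ℝ≥0∞) +
      e * ENNReal.ofReal (weightedDist N (fun _ => 1) x y) + siteAverage N α i H y +
      (ENNReal.ofReal ((2 * α - 1) / s * neighbourDist i x y) + shortInterval s i y) := by
  have hβ := isProbabilityMeasureBeta (by linarith : 0 < α) (by linarith : 0 < α)
  have hp : 1 ≤ 2 * α - 1 := by linarith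
  have hle1 : siteAverage N α i g x ≤ 1 := by
    refine (lintegral_mono fun u => hg1 _).trans ?_
    simp
  -- When the interval of `y` is short, or the displacement is at least `s`, the error term is
  -- already at least `1` and `g ≤ 1` suffices. Shortness is tested on `y` only, because `y` is the
  -- configuration that will be at equilibrium.
  by_cases hlen : pos N y ((i : ℕ) + 2) - pos N y i < s
  · refine hle1.trans (le_add_left (le_add_left (le_of_eq ?_)))
    rw [shortInterval, Set.indicator_of_mem (by exact hlen), Pi.one_apply]
  rw [not_lt] at hlen
  by_cases hΔ : s ≤ neighbourDist i x y
  · refine hle1.trans (le_add_left (le_add_right ?_))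
    rw [ENNReal.one_le_ofReal, div_mul_eq_mul_div, one_le_div hs]
    nlinarith
  rw [not_le] at hΔ
  set a := pos N x i
  set b := pos N x (i + 2)
  set a' := pos N y i
  set b' := pos N y (i + 2)
  set A := max a a' with hA
  set B := min b b' with hB
  set M := max (b - a) (b' - a') with hM
  have hMs : s ≤ M := hlen.trans (le_max_right _ _)
  have hM0 : 0 < M := hs.trans_le hMs
  -- The intersection `[A, B]` of the two intervals is shorter than the longer one by at most the
  -- total displacement of the end points.
  have hBA : M - neighbourDist i x y ≤ B - A := by
    have h1 := abs_le.1 (le_refl |a - a'|)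
    have h2 := abs_le.1 (le_refl |b - b'|)
    have h3 : neighbourDist i x y = |a - a'| + |b - b'| := rfl
    rcases max_cases (b - a) (b' - a') with h4 | h4 <;> rcases max_cases a a' with h5 | h5 <;>
      rcases min_cases b b' with h6 | h6 <;> rw [hM, hA, hB, h3, h4.1, h5.1, h6.1] <;> linarith
  have hAB : A < B := by linarith
  -- Dividing by the longer length gives one constant that minorizes both Beta laws by the Beta law
  -- on `[A, B]`.
  set l := ((B - A) / M) ^ (2 * α - 1)
  have hq0 : 0 ≤ (B - A) / M := div_nonneg (by linarith) hM0.le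
  have haA : a ≤ A := le_max_left _ _
  have haA' : a' ≤ A := le_max_right _ _
  have hBb : B ≤ b := min_le_left _ _
  have hBb' : B ≤ b' := min_le_right _ _
  have hq1 : (B - A) / M ≤ 1 := by
    rw [div_le_one hM0]
    exact le_trans (by linarith) (le_max_left _ _)
  have hl1 : ENNReal.ofReal l ≤ 1 := by
    rw [ENNReal.ofReal_le_one]
    exact Real.rpow_le_one hq0 hq1 (by linarith)
  have hlx : l ≤ ((B - A) / (b - a)) ^ (2 * α - 1) :=
    Real.rpow_le_rpow hq0 (div_le_div_of_nonneg_left (by linarith) (by linarith)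
      (le_max_left _ _)) (by linarith)
  have hly : l ≤ ((B - A) / (b' - a')) ^ (2 * α - 1) :=
    Real.rpow_le_rpow hq0 (div_le_div_of_nonneg_left (by linarith) (by linarith)
      (le_max_right _ _)) (by linarith)
  have hΔ0 := neighbourDist_nonneg i x y
  have hr : 1 ≤ ENNReal.ofReal l + ENNReal.ofReal ((2 * α - 1) / s * neighbourDist i x y) := by
    rw [← ENNReal.ofReal_add (by positivity) (mul_nonneg (div_nonneg (by linarith) hs.le) hΔ0),
      ENNReal.one_le_ofReal]
    -- Bernoulli's inequality makes the lost mass `1 - l` linear in the displacement.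
    have h1 := one_le_rpow_add (t := neighbourDist i x y / M) hp
      (by rw [div_le_one hM0]; linarith)
    have h2 : 1 - neighbourDist i x y / M ≤ (B - A) / M := by
      rw [one_sub_div hM0.ne']
      gcongr
    have h3 : (1 - neighbourDist i x y / M) ^ (2 * α - 1) ≤ l :=
      Real.rpow_le_rpow (by rw [sub_nonneg, div_le_one hM0]; linarith) h2 (by linarith)
    have h4 : (2 * α - 1) * (neighbourDist i x y / M) ≤ (2 * α - 1) / s * neighbourDist i x y := by
      rw [div_mul_eq_mul_div, mul_div_assoc]
      gcongr
    linarith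
  have hup : ∀ w : Config N, Measurable fun z : ℝ => Function.update w i z := fun w =>
    measurable_update w
  -- The minorization is applied to `1 - g`, which turns it into an upper bound for the average of
  -- `g`.
  have h1 : siteAverage N α i g x ≤ ENNReal.ofReal l *
      ∫⁻ u, g (Function.update x i (u * A + (1 - u) * B)) ∂(betaMeasure α α) +
      ENNReal.ofReal ((2 * α - 1) / s * neighbourDist i x y) :=
    le_mul_add_of_minorization
      (lintegral_add_one_sub _ (hg.comp (measurable_resample_right N i x)) fun u => hg1 _)
      (lintegral_add_one_sub _ (F := fun u => g (Function.update x i (u * A + (1 - u) * B)))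
        (by fun_prop) fun u => hg1 _)
      ((mul_le_mul_left (ENNReal.ofReal_le_ofReal hlx) _).trans
        (betaMeasure_minorization_interval hα haA hAB hBb
          (F := fun z => 1 - g (Function.update x i z)) (by fun_prop))) hr
  have h2 : ∀ F : Config N → ℝ≥0∞, Measurable F → ENNReal.ofReal l *
      ∫⁻ u, F (Function.update y i (u * A + (1 - u) * B)) ∂(betaMeasure α α) ≤
      siteAverage N α i F y := fun F hF =>
    (mul_le_mul_left (ENNReal.ofReal_le_ofReal hly) _).trans
      (betaMeasure_minorization_interval hα haA' hAB hBb'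
        (F := fun z => F (Function.update y i z)) (hF.comp (hup y)))
  set K : ℝ≥0∞ := c * (hammingDistOff i x y : ℝ≥0∞) +
    e * ENNReal.ofReal (weightedDist N (fun _ => 1) x y) with hK
  -- On the common part both configurations receive the same value at `i`, so that site no longer
  -- contributes to either distance.
  have h3 : ∫⁻ u, g (Function.update x i (u * A + (1 - u) * B)) ∂(betaMeasure α α) ≤
      ∫⁻ u, g (Function.update y i (u * A + (1 - u) * B)) ∂(betaMeasure α α) + K +
      ∫⁻ u, H (Function.update y i (u * A + (1 - u) * B)) ∂(betaMeasure α α) := by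
    have hm : Measurable fun u : ℝ => g (Function.update y i (u * A + (1 - u) * B)) + K := by
      fun_prop
    have hm' : Measurable fun u : ℝ => g (Function.update y i (u * A + (1 - u) * B)) := by
      fun_prop
    have hc : ∫⁻ _, K ∂(betaMeasure α α) = K := by simp
    refine (lintegral_mono_ae (g := fun u => g (Function.update y i (u * A + (1 - u) * B)) + K +
      H (Function.update y i (u * A + (1 - u) * B))) ?_).trans_eq
      (by rw [lintegral_add_left hm, lintegral_add_left hm', hc])
    filter_upwards [ae_betaMeasure α α] with u hu
    have hz1 : A ≤ u * A + (1 - u) * B := by nlinarith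
    have hz2 : u * A + (1 - u) * B ≤ B := by nlinarith
    refine (h _ (update_mem_Omega hx i (haA.trans hz1) (hz2.trans hBb)) _
      (update_mem_Omega hy i (haA'.trans hz1) (hz2.trans hBb'))).trans ?_
    rw [hammingDist_update, add_assoc (g _), hK]
    gcongr
    rw [weightedDist_update]
    simp
  have h4 := h2 g hg
  have h5 := h2 H hH
  set X := ∫⁻ u, g (Function.update y i (u * A + (1 - u) * B)) ∂(betaMeasure α α)
  set Y := ∫⁻ u, H (Function.update y i (u * A + (1 - u) * B)) ∂(betaMeasure α α)
  calc siteAverage N α i g x ≤ _ := h1.trans (add_le_add_left (mul_le_mul_right h3 _) _)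
    _ = ENNReal.ofReal l * X + ENNReal.ofReal l * K + ENNReal.ofReal l * Y +
        ENNReal.ofReal ((2 * α - 1) / s * neighbourDist i x y) := by
        rw [mul_add, mul_add]
    _ ≤ siteAverage N α i g y + 1 * K + siteAverage N α i H y +
        ENNReal.ofReal ((2 * α - 1) / s * neighbourDist i x y) := by
        gcongr
    _ ≤ _ := by
        rw [one_mul, hK, ← add_assoc]
        exact add_le_add_right (le_add_right le_rfl) _

/-! ### The merging phase over many steps. -/

lemma measurable_shortInterval {N : ℕ} (s : ℝ) (i : Fin (N - 1)) :
    Measurable (shortInterval s i) :=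
  measurable_one.indicator
    (measurableSet_lt ((measurable_pos N _).sub (measurable_pos N _)) measurable_const)

lemma lintegral_shortInterval_le {N : ℕ} (i : Fin (N - 1)) {α : ℝ} (hα : 1 ≤ α) (s : ℝ) :
    ∫⁻ y, shortInterval s i y ∂(equilibrium N α) ≤
      ENNReal.ofReal (s * (α * (Real.Gamma (α - 1 / 2) / Real.Gamma α) ^ 2)) := by
  refine le_of_eq_of_le ?_ (equilibrium_interval_lt i hα s)
  exact lintegral_indicator_one
    (measurableSet_lt ((measurable_pos N _).sub (measurable_pos N _)) measurable_const)

noncomputable section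

/-- The probability that a uniformly chosen site has neighbours at distance less than `s`. -/
def shortFraction (N : ℕ) (s : ℝ) (y : Config N) : ℝ≥0∞ :=
  ((N - 1 : ℕ) : ℝ≥0∞)⁻¹ * ∑ i : Fin (N - 1), shortInterval s i y

end

lemma measurable_shortFraction (N : ℕ) (s : ℝ) : Measurable (shortFraction N s) :=
  (Finset.measurable_fun_sum _ fun i _ => measurable_shortInterval s i).const_mul _

lemma lintegral_shortFraction_le {N : ℕ} (hN : 2 ≤ N) {α : ℝ} (hα : 1 ≤ α) (s : ℝ) :
    ∫⁻ y, shortFraction N s y ∂(equilibrium N α) ≤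
      ENNReal.ofReal (s * (α * (Real.Gamma (α - 1 / 2) / Real.Gamma α) ^ 2)) := by
  have h0 : ((N - 1 : ℕ) : ℝ≥0∞) ≠ 0 := by
    rw [Nat.cast_ne_zero]; omega
  unfold shortFraction
  rw [lintegral_const_mul _ (Finset.measurable_fun_sum _ fun i _ => measurable_shortInterval s i),
    lintegral_finsetSum _ fun i _ => measurable_shortInterval s i]
  refine (mul_le_mul_right (Finset.sum_le_sum fun i _ =>
    lintegral_shortInterval_le i hα s) _).trans_eq ?_
  rw [Finset.sum_const, Finset.card_univ, Fintype.card_fin, nsmul_eq_mul, ← mul_assoc,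
    ENNReal.inv_mul_cancel h0 (ENNReal.natCast_ne_top _), one_mul]

/-- Averaging over sites shrinks the Hamming coefficient, while the distance coefficient grows by a
fixed amount: a position neighbours at most two sites, hence the factor `2 / (N - 1)`. -/
lemma average_coupling {N : ℕ} (hN : 2 ≤ N) {α : ℝ} (hα : 1 ≤ α) {g H : Config N → ℝ≥0∞}
    (hg : Measurable g) (hg1 : ∀ x, g x ≤ 1) (hH : Measurable H) {c e : ℝ≥0∞} {s : ℝ} (hs : 0 < s)
    (h : ∀ x ∈ Omega N, ∀ y ∈ Omega N, g x ≤ g y + c * (hammingDist x y : ℝ≥0∞) +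
      e * ENNReal.ofReal (weightedDist N (fun _ => 1) x y) + H y)
    {x y : Config N} (hx : x ∈ Omega N) (hy : y ∈ Omega N) :
    average N α g x ≤ average N α g y +
      c * ENNReal.ofReal (1 - 1 / ((N - 1 : ℕ) : ℝ)) * (hammingDist x y : ℝ≥0∞) +
      (e + ENNReal.ofReal (2 * (2 * α - 1) / (s * ((N - 1 : ℕ) : ℝ)))) *
        ENNReal.ofReal (weightedDist N (fun _ => 1) x y) +
      (average N α H y + shortFraction N s y) := by
  have h0 : ((N - 1 : ℕ) : ℝ≥0∞) ≠ 0 := by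
    rw [Nat.cast_ne_zero]; omega
  have hd : (0 : ℝ) < ((N - 1 : ℕ) : ℝ) := by
    have : 0 < N - 1 := by omega
    exact_mod_cast this
  have hp : 0 ≤ 2 * α - 1 := by linarith
  have hinv : ((N - 1 : ℕ) : ℝ≥0∞)⁻¹ = ENNReal.ofReal (((N - 1 : ℕ) : ℝ)⁻¹) := by
    rw [ENNReal.ofReal_inv_of_pos hd, ENNReal.ofReal_natCast]
  have hham : ((N - 1 : ℕ) : ℝ≥0∞)⁻¹ * ∑ i : Fin (N - 1), (hammingDistOff i x y : ℝ≥0∞) =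
      ENNReal.ofReal (1 - 1 / ((N - 1 : ℕ) : ℝ)) * (hammingDist x y : ℝ≥0∞) := by
    rw [← Nat.cast_sum, hinv, ← ENNReal.ofReal_natCast, ← ENNReal.ofReal_natCast (hammingDist x y),
      ← ENNReal.ofReal_mul (by positivity), ← ENNReal.ofReal_mul' (by positivity)]
    congr 1
    have := congrArg (Nat.cast (R := ℝ)) (sum_hammingDistOff x y)
    rw [Nat.cast_add, Nat.cast_mul] at this
    field_simp
    linarith
  have hnei : ((N - 1 : ℕ) : ℝ≥0∞)⁻¹ *
      ∑ i : Fin (N - 1), ENNReal.ofReal ((2 * α - 1) / s * neighbourDist i x y) ≤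
      ENNReal.ofReal (2 * (2 * α - 1) / (s * ((N - 1 : ℕ) : ℝ))) *
        ENNReal.ofReal (weightedDist N (fun _ => 1) x y) := by
    rw [← ENNReal.ofReal_sum_of_nonneg fun i _ => mul_nonneg (div_nonneg hp hs.le)
      (neighbourDist_nonneg i x y), hinv, ← ENNReal.ofReal_mul (by positivity),
      ← ENNReal.ofReal_mul (by positivity), ← Finset.mul_sum]
    refine ENNReal.ofReal_le_ofReal ?_
    calc _ ≤ ((N - 1 : ℕ) : ℝ)⁻¹ * ((2 * α - 1) / s * (2 * weightedDist N (fun _ => 1) x y)) := by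
          gcongr
          exact sum_neighbourDist_le hN x y
      _ = _ := by field_simp
  unfold average
  refine (mul_le_mul_right (Finset.sum_le_sum fun i _ =>
    siteAverage_coupling hα hg hg1 hH hs h hx hy i) _).trans ?_
  simp only [Finset.sum_add_distrib, mul_add, ← Finset.mul_sum, add_mul]
  rw [mul_left_comm _ c, hham, Finset.sum_const, Finset.card_univ, Fintype.card_fin, nsmul_eq_mul,
    mul_left_comm _ e, ← mul_assoc _ ((N - 1 : ℕ) : ℝ≥0∞),
    ENNReal.inv_mul_cancel h0 (ENNReal.natCast_ne_top _), one_mul, mul_assoc c]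
  refine (add_le_add_right (add_le_add_left hnei _) _).trans_eq ?_
  rw [shortFraction]
  ring

lemma iterate_average_coupling {N : ℕ} (hN : 2 ≤ N) {α : ℝ} (hα : 1 ≤ α) {f : Config N → ℝ≥0∞}
    (hf : Measurable f) (hf1 : ∀ x, f x ≤ 1) {s : ℝ} (hs : 0 < s) (n : ℕ) :
    ∃ H : Config N → ℝ≥0∞, Measurable H ∧
      ∫⁻ y, H y ∂(equilibrium N α) ≤
        n * ENNReal.ofReal (s * (α * (Real.Gamma (α - 1 / 2) / Real.Gamma α) ^ 2)) ∧
      ∀ x ∈ Omega N, ∀ y ∈ Omega N, (average N α)^[n] f x ≤ (average N α)^[n] f y +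
        ENNReal.ofReal (1 - 1 / ((N - 1 : ℕ) : ℝ)) ^ n * (hammingDist x y : ℝ≥0∞) +
        n * ENNReal.ofReal (2 * (2 * α - 1) / (s * ((N - 1 : ℕ) : ℝ))) *
          ENNReal.ofReal (weightedDist N (fun _ => 1) x y) + H y := by
  induction n with
  | zero =>
    -- With no steps left, distinct configurations have Hamming distance at least `1`, which
    -- dominates `f ≤ 1`.
    refine ⟨0, measurable_zero, by simp, fun x _ y _ => ?_⟩
    by_cases hxy : x = y
    · subst hxy; simp
    · have : (1 : ℝ≥0∞) ≤ hammingDist x y := by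
        exact_mod_cast Nat.one_le_iff_ne_zero.2 (hammingDist_ne_zero.2 hxy)
      simpa using (hf1 x).trans (this.trans le_add_self)
  | succ n ih =>
    obtain ⟨H, hH, hI, h⟩ := ih
    refine ⟨fun y => average N α H y + shortFraction N s y,
      (measurable_average α hH).add (measurable_shortFraction N s), ?_, fun x hx y hy => ?_⟩
    · rw [lintegral_add_left (measurable_average α hH), lintegral_average_equilibrium hN hα hH,
        Nat.cast_succ, add_mul, one_mul]
      exact add_le_add hI (lintegral_shortFraction_le hN hα s)
    · simp only [Function.iterate_succ_apply']
      refine (average_coupling hN hα (measurable_iterate_average α hf n)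
        (iterate_average_le_one hN (by linarith) hf1 n) hH hs h hx hy).trans_eq ?_
      rw [pow_succ, Nat.cast_succ, add_mul (n : ℝ≥0∞) 1, one_mul]

/-! ### Comparison of the distances and combination of the two phases. -/

/-- Jordan's inequality on the left half, reflection on the right half. This is what lets the
unweighted distance of the merging phase be controlled by the contracted one, at the cost of a
factor `N / 2`. -/
lemma two_div_le_sineWeight {N k : ℕ} (hk0 : 1 ≤ k) (hk : k + 1 ≤ N) :
    2 / (N : ℝ) ≤ sineWeight N k := by
  have hN : (0 : ℝ) < N := by
    have : 0 < N := by omega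
    exact_mod_cast this
  have hk0' : (1 : ℝ) ≤ k := by exact_mod_cast hk0
  have hk' : (k : ℝ) + 1 ≤ N := by exact_mod_cast hk
  have hpi := Real.pi_pos
  have key : ∀ j : ℝ, 1 ≤ j → j ≤ N / 2 → 2 / (N : ℝ) ≤ Real.sin (j * (Real.pi / N)) := by
    intro j hj hj'
    refine le_trans ?_ (Real.mul_le_sin (by positivity) ?_)
    · rw [show 2 / Real.pi * (j * (Real.pi / N)) = 2 * j / N by field_simp]
      gcongr
      linarith
    · calc j * (Real.pi / N) ≤ N / 2 * (Real.pi / N) := by gcongr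
        _ = Real.pi / 2 := by field_simp
  rcases le_total (k : ℝ) (N / 2) with h | h
  · exact key k hk0' h
  · have h1 := key (N - k) (by linarith) (by linarith)
    rwa [show ((N : ℝ) - k) * (Real.pi / N) = Real.pi - k * (Real.pi / N) by field_simp,
      Real.sin_pi_sub] at h1

lemma weightedDist_one_le {N : ℕ} (hN : 2 ≤ N) (x y : Config N) :
    weightedDist N (fun _ => 1) x y ≤ N / 2 * weightedDist N (sineWeight N) x y := by
  have hN0 : (0 : ℝ) < N := by
    have : 0 < N := by omega
    exact_mod_cast this
  rw [weightedDist_eq_sum (by omega), weightedDist_eq_sum (by omega), Finset.mul_sum]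
  refine Finset.sum_le_sum fun i _ => ?_
  have h := two_div_le_sineWeight (N := N) (k := i + 1) (by omega) (by have := i.2; omega)
  rw [← mul_assoc]
  refine mul_le_mul_of_nonneg_right ?_ (abs_nonneg _)
  calc (1 : ℝ) = N / 2 * (2 / N) := by field_simp
    _ ≤ _ := by gcongr

lemma weightedDist_sineWeight_le {N : ℕ} (hN : 1 ≤ N) {x y : Config N} (hx : x ∈ Omega N)
    (hy : y ∈ Omega N) : weightedDist N (sineWeight N) x y ≤ (N : ℝ) ^ 2 := by
  rw [weightedDist_eq_sum hN]
  calc _ ≤ ∑ i : Fin (N - 1), (N : ℝ) := by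
        refine Finset.sum_le_sum fun i _ => ?_
        have hi : (i : ℕ) + 1 ≤ N := by have := i.2; omega
        have h1 := pos_mem_Icc hN hx hi
        have h2 := pos_mem_Icc hN hy hi
        calc _ ≤ 1 * |pos N x (i + 1) - pos N y (i + 1)| :=
              mul_le_mul_of_nonneg_right (sineWeight_le_one _ _) (abs_nonneg _)
          _ ≤ N := by rw [one_mul, abs_le]; constructor <;> linarith
    _ ≤ (N : ℝ) ^ 2 := by
        rw [Finset.sum_const, Finset.card_univ, Fintype.card_fin, nsmul_eq_mul, sq]
        gcongr
        exact_mod_cast Nat.sub_le N 1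

noncomputable section

/-- The constant `C` in the bound `C s` for the equilibrium probability that the neighbours of a
given site are at distance less than `s`. -/
def shortConst (α : ℝ) : ℝ := α * (Real.Gamma (α - 1 / 2) / Real.Gamma α) ^ 2

/-- The contraction factor of one step of the averaged dynamics. -/
def contractionRate (N : ℕ) : ℝ := 1 - gap N / ((N - 1 : ℕ) : ℝ)

/-- The prefactor of the contribution of the initial distance to the failure probability of
the coupling. -/
def distError (N : ℕ) (α s : ℝ) (m : ℕ) : ℝ :=
  m * (2 * (2 * α - 1) / (s * ((N - 1 : ℕ) : ℝ))) * (N / 2) * (N : ℝ) ^ 2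

/-- The probability that a site is not updated in `m` steps or that a short interval occurs. -/
def updateError (N : ℕ) (α s : ℝ) (m : ℕ) : ℝ :=
  (1 - 1 / ((N - 1 : ℕ) : ℝ)) ^ m * ((N - 1 : ℕ) : ℝ) + m * (s * shortConst α)

end

lemma shortConst_nonneg {α : ℝ} (hα : 0 ≤ α) : 0 ≤ shortConst α :=
  mul_nonneg hα (sq_nonneg _)

lemma cast_pred_pos {N : ℕ} (hN : 2 ≤ N) : (1 : ℝ) ≤ ((N - 1 : ℕ) : ℝ) := by
  exact_mod_cast (by omega : 1 ≤ N - 1)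

lemma distError_nonneg {N : ℕ} {α s : ℝ} (hα : 1 ≤ α) (hs : 0 < s) (m : ℕ) :
    0 ≤ distError N α s m := by
  have : 0 ≤ 2 * α - 1 := by linarith
  unfold distError
  positivity

lemma updateError_nonneg {N : ℕ} (hN : 2 ≤ N) {α s : ℝ} (hα : 1 ≤ α) (hs : 0 < s) (m : ℕ) :
    0 ≤ updateError N α s m := by
  have h1 : 0 ≤ 1 - 1 / ((N - 1 : ℕ) : ℝ) := by
    rw [sub_nonneg, div_le_one (by linarith [cast_pred_pos hN])]
    exact cast_pred_pos hN
  have h2 := shortConst_nonneg (by linarith : 0 ≤ α)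
  unfold updateError
  positivity

/-- The outer iterates are the earlier times: `n` contracting steps, then `m` merging steps. The
starting distance is at most `N ^ 2`, and `y` is averaged over equilibrium. -/
lemma iterate_average_le {N : ℕ} (hN : 2 ≤ N) {α : ℝ} (hα : 1 ≤ α) {s : ℝ} (hs : 0 < s)
    (hρ : 0 ≤ contractionRate N) {f : Config N → ℝ≥0∞} (hf : Measurable f)
    (hf1 : ∀ x, f x ≤ 1) {x : Config N} (hx : x ∈ Omega N) (m n : ℕ) :
    (average N α)^[n + m] f x ≤ ∫⁻ y, f y ∂(equilibrium N α) +
      ENNReal.ofReal (distError N α s m * contractionRate N ^ n + updateError N α s m) := by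
  have hπ := isProbabilityMeasure_equilibrium (by omega : 1 ≤ N) hα
  have hα0 : 0 < α := by linarith
  have hd := cast_pred_pos hN
  have hp : 0 ≤ 2 * α - 1 := by linarith
  have hκ : 0 ≤ 1 - 1 / ((N - 1 : ℕ) : ℝ) := by
    rw [sub_nonneg, div_le_one (by linarith)]; exact hd
  have hC := shortConst_nonneg hα0.le
  obtain ⟨H, hH, hHint, hcoup⟩ := iterate_average_coupling hN hα hf hf1 hs m
  set q : ℝ := 2 * (2 * α - 1) / (s * ((N - 1 : ℕ) : ℝ)) with hq
  have hq0 : 0 ≤ q := by positivity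
  set K : ℝ≥0∞ := ENNReal.ofReal ((1 - 1 / ((N - 1 : ℕ) : ℝ)) ^ m * ((N - 1 : ℕ) : ℝ)) with hK
  set e : ℝ≥0∞ := ENNReal.ofReal (m * q * (N / 2)) with he
  have hbase : ∀ x ∈ Omega N, ∀ y ∈ Omega N, (average N α)^[m] f x ≤ (average N α)^[m] f y +
      e * ENNReal.ofReal (weightedDist N (sineWeight N) x y) + (K + H y) := by
    intro x hx y hy
    refine (hcoup x hx y hy).trans ?_
    have h1 : ENNReal.ofReal (1 - 1 / ((N - 1 : ℕ) : ℝ)) ^ m * (hammingDist x y : ℝ≥0∞) ≤ K := by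
      rw [hK, ENNReal.ofReal_mul (by positivity), ENNReal.ofReal_pow hκ, ENNReal.ofReal_natCast]
      gcongr
      simpa using hammingDist_le_card_fintype (x := x) (y := y)
    have h2 : (m : ℝ≥0∞) * ENNReal.ofReal q * ENNReal.ofReal (weightedDist N (fun _ => 1) x y) ≤
        e * ENNReal.ofReal (weightedDist N (sineWeight N) x y) := by
      rw [he, ← ENNReal.ofReal_natCast, ← ENNReal.ofReal_mul (by positivity),
        ← ENNReal.ofReal_mul (by positivity), ← ENNReal.ofReal_mul (by positivity)]
      refine ENNReal.ofReal_le_ofReal ?_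
      rw [mul_assoc (_ * q)]
      exact mul_le_mul_of_nonneg_left (weightedDist_one_le hN x y) (by positivity)
    calc _ ≤ (average N α)^[m] f y + K +
          e * ENNReal.ofReal (weightedDist N (sineWeight N) x y) + H y := by gcongr
      _ = _ := by ring
  have hcontr := iterate_average_contraction hN hα0 (measurable_iterate_average α hf m) hρ hbase n
    x hx
  rw [Function.iterate_add_apply]
  set F := (average N α)^[n] ((average N α)^[m] f) with hF
  have hFm : Measurable F := measurable_iterate_average α (measurable_iterate_average α hf m) n
  set E : ℝ≥0∞ := e * ENNReal.ofReal (contractionRate N ^ n) * ENNReal.ofReal ((N : ℝ) ^ 2) with hE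
  have hKH : Measurable fun y => K + H y := hH.const_add K
  calc F x = ∫⁻ _, F x ∂(equilibrium N α) := by simp
    _ ≤ ∫⁻ y, (F y + E + (average N α)^[n] (fun y => K + H y) y) ∂(equilibrium N α) := by
        refine lintegral_mono_ae ?_
        filter_upwards [ae_equilibrium N α] with y hy
        refine (hcontr y hy).trans ?_
        rw [hE]
        gcongr
        · exact le_rfl
        · exact weightedDist_sineWeight_le (by omega) hx hy
    _ = ∫⁻ y, f y ∂(equilibrium N α) + E + (K + ∫⁻ y, H y ∂(equilibrium N α)) := by
        rw [lintegral_add_left (hFm.add_const E), lintegral_add_left hFm,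
          lintegral_iterate_average_equilibrium hN hα hKH,
          lintegral_iterate_average_equilibrium hN hα (measurable_iterate_average α hf m),
          lintegral_iterate_average_equilibrium hN hα hf, lintegral_add_left measurable_const]
        simp
    _ ≤ ∫⁻ y, f y ∂(equilibrium N α) + E + (K + m * ENNReal.ofReal (s * shortConst α)) := by
        gcongr
        exact hHint
    _ = _ := by
        rw [hE, he, hK, ← ENNReal.ofReal_mul (by positivity), ← ENNReal.ofReal_mul (by positivity),
          ← ENNReal.ofReal_natCast m, ← ENNReal.ofReal_mul (by positivity),
          ← ENNReal.ofReal_add (by positivity) (by positivity), add_assoc,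
          ← ENNReal.ofReal_add (by positivity) (by positivity)]
        congr 2
        unfold distError updateError
        ring

/-! ### Return to continuous time and choice of parameters. -/

lemma law_le {N : ℕ} (hN : 2 ≤ N) {α : ℝ} (hα : 1 ≤ α) {s : ℝ} (hs : 0 < s)
    (hρ : 0 < contractionRate N) {B : Set (Config N)} (hB : MeasurableSet B)
    {x : Config N} (hx : x ∈ Omega N) (m : ℕ) {t : ℝ} (ht : 0 ≤ t) :
    (law N α t x).real B ≤ (equilibrium N α).real B + (updateError N α s m +
      (distError N α s m + 1) / contractionRate N ^ m * Real.exp (-(gap N * t))) := by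
  have hπ := isProbabilityMeasure_equilibrium (by omega : 1 ≤ N) hα
  have hd := cast_pred_pos hN
  set d : ℝ := ((N - 1 : ℕ) : ℝ) with hd_def
  set ρ := contractionRate N with hρ_def
  have hρ1 : ρ ≤ 1 := sub_le_self _ (div_nonneg (gap_nonneg N) (by linarith))
  set f : Config N → ℝ≥0∞ := B.indicator 1 with hf_def
  have hf : Measurable f := measurable_one.indicator hB
  have hf1 : ∀ x, f x ≤ 1 := fun x => Set.indicator_le_self _ _ x
  set b := (equilibrium N α).real B with hb
  have hb0 : 0 ≤ b := measureReal_nonneg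
  have hfb : ∫⁻ y, f y ∂(equilibrium N α) = ENNReal.ofReal b := by
    rw [hf_def, lintegral_indicator_one hB, hb, ofReal_measureReal]
  set E1 := distError N α s m
  set E2 := updateError N α s m
  have hE10 : 0 ≤ E1 := distError_nonneg hα hs m
  have hE20 : 0 ≤ E2 := updateError_nonneg hN hα hs m
  have hρm : 0 < ρ ^ m := pow_pos hρ m
  -- A single geometric bound for all `n`: dividing by `ρ ^ m` accounts for the merging steps, and
  -- the extra `+ 1` makes the bound trivially true when `n < m`.
  have hn : ∀ n, (average N α)^[n] f x ≤
      ENNReal.ofReal ((b + E2) + (E1 + 1) / ρ ^ m * ρ ^ n) := by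
    intro n
    rcases lt_or_ge n m with h | h
    · refine (iterate_average_le_one hN (by linarith) hf1 n x).trans ?_
      rw [ENNReal.one_le_ofReal]
      have h1 : ρ ^ m ≤ ρ ^ n := pow_le_pow_of_le_one hρ.le hρ1 h.le
      have h2 : 1 ≤ (E1 + 1) / ρ ^ m * ρ ^ n := by
        rw [div_mul_eq_mul_div, one_le_div hρm]
        nlinarith
      linarith
    · obtain ⟨k, rfl⟩ := Nat.exists_eq_add_of_le' h
      refine (iterate_average_le hN hα hs hρ.le hf hf1 hx m k).trans ?_
      rw [hfb, ← ENNReal.ofReal_add hb0 (by positivity)]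
      refine ENNReal.ofReal_le_ofReal ?_
      rw [pow_add, div_mul_eq_mul_div, mul_comm (ρ ^ k) (ρ ^ m), mul_left_comm,
        mul_div_cancel_left₀ _ hρm.ne']
      have : 0 ≤ ρ ^ k := by positivity
      linarith
  have hup : ∀ n, updates N α n x B = ENNReal.ofReal (d ^ n) * (average N α)^[n] f x := by
    intro n
    rw [ENNReal.ofReal_pow (by linarith), hd_def, ENNReal.ofReal_natCast,
      ← lintegral_updates hN n hf x, hf_def, lintegral_indicator_one hB]
  set A := (E1 + 1) / ρ ^ m with hA
  have hA0 : 0 ≤ A := by positivity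
  -- The generating function of the Poisson law of mean `d * t` at `ρ` is `exp (-d t (1 - ρ))`, and
  -- `d * (1 - ρ) = gap N`.
  have hsum : HasSum (fun n : ℕ => Real.exp (-(d * t)) * (t ^ n / (n.factorial : ℝ)) *
      (d ^ n * ((b + E2) + A * ρ ^ n))) (b + E2 + A * Real.exp (-(gap N * t))) := by
    have h1 := (NormedSpace.expSeries_div_hasSum_exp (d * t)).mul_left
      (Real.exp (-(d * t)) * (b + E2))
    have h2 := (NormedSpace.expSeries_div_hasSum_exp (d * t * ρ)).mul_left
      (Real.exp (-(d * t)) * A)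
    have h3 := h1.add h2
    rw [← Real.exp_eq_exp_ℝ] at h3
    have h4 : Real.exp (-(gap N * t)) = Real.exp (-(d * t)) * Real.exp (d * t * ρ) := by
      rw [← Real.exp_add, hρ_def, contractionRate, ← hd_def]
      congr 1
      field_simp
      ring
    have h5 : Real.exp (-(d * t)) * Real.exp (d * t) = 1 := by
      rw [← Real.exp_add, neg_add_cancel, Real.exp_zero]
    convert! h3 using 1
    · funext n
      rw [mul_pow (d * t), mul_pow]
      ring
    · rw [h4]
      linear_combination (-(b + E2)) * h5
  have hle : law N α t x B ≤ ENNReal.ofReal (b + E2 + A * Real.exp (-(gap N * t))) := by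
    rw [law, Measure.sum_apply _ hB, ← hsum.tsum_eq,
      ENNReal.ofReal_tsum_of_nonneg (fun n => by positivity) hsum.summable]
    refine ENNReal.tsum_le_tsum fun n => ?_
    rw [Measure.smul_apply, smul_eq_mul, hup,
      ENNReal.ofReal_mul (p := Real.exp (-(d * t)) * (t ^ n / (n.factorial : ℝ))) (by positivity),
      ENNReal.ofReal_mul (p := d ^ n) (by positivity)]
    exact mul_le_mul_right (mul_le_mul_right (hn n) _) _
  refine (ENNReal.toReal_mono ENNReal.ofReal_ne_top hle).trans_eq ?_
  rw [ENNReal.toReal_ofReal (by positivity)]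
  ring

lemma worstDist_le {N : ℕ} (hN : 2 ≤ N) {α : ℝ} (hα : 1 ≤ α) {s : ℝ} (hs : 0 < s)
    (hρ : 0 < contractionRate N) (m : ℕ) {t : ℝ} (ht : 0 ≤ t) :
    worstDist N α t ≤ updateError N α s m +
      (distError N α s m + 1) / contractionRate N ^ m * Real.exp (-(gap N * t)) := by
  have h1 := updateError_nonneg hN hα hs m
  have h2 := distError_nonneg (N := N) hα hs m
  have h0 : 0 ≤ updateError N α s m +
      (distError N α s m + 1) / contractionRate N ^ m * Real.exp (-(gap N * t)) := by positivity
  -- Real suprema default to `0`, hence the need for a nonnegative bound.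
  refine Real.iSup_le (fun x => Real.iSup_le (fun B => ?_) h0) h0
  rw [sub_le_iff_le_add']
  exact law_le hN hα hs hρ B.2.1 x.2 m ht

lemma gap_le (N : ℕ) : gap N ≤ 5 / (N : ℝ) ^ 2 := by
  have h := Real.one_sub_sq_div_two_le_cos (x := Real.pi / N)
  have h2 : (Real.pi / N) ^ 2 / 2 ≤ 5 / (N : ℝ) ^ 2 := by
    rw [div_pow, div_right_comm]
    gcongr
    nlinarith [Real.pi_lt_d2, Real.pi_pos]
  unfold gap
  linarith

lemma gap_pos {N : ℕ} (hN : 1 ≤ N) : 0 < gap N := by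
  have hN0 : (1 : ℝ) ≤ N := by exact_mod_cast hN
  have h := Real.cos_lt_cos_of_nonneg_of_le_pi le_rfl
    (div_le_self Real.pi_pos.le hN0) (by positivity : 0 < Real.pi / N)
  rw [Real.cos_zero] at h
  exact sub_pos.2 h

/-- With `v = N ^ (1/4)`, all quantities become powers of `v`. Taking `m / (N - 1)` between `v` and
`4 v` leaves a site unmerged with probability at most `v ^ 4 * exp (-v)`; `s = v ^ (-6)` makes the
short-interval error `O(1 / v)`. The distance prefactor is then `O(v ^ 19)`, against `exp (-gap N *
t) = v ^ (-20)`. -/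
lemma worstDist_le_div {N : ℕ} (hN : 40 ≤ N) {α : ℝ} (hα : 1 ≤ α) {v : ℝ} (hv0 : 1 ≤ v)
    (hv : v ^ 4 = N) :
    worstDist N α (5 * Real.log N / gap N) ≤
      (8 * (2 * α - 1) + 2 + 120 + 2 * shortConst α) / v := by
  have hN2 : 2 ≤ N := by omega
  have hN0 : (40 : ℝ) ≤ N := by exact_mod_cast hN
  have hgap := gap_pos (by omega : 1 ≤ N)
  have hd : ((N - 1 : ℕ) : ℝ) = N - 1 := by rw [Nat.cast_sub (by omega)]; simp
  have hdN : (N : ℝ) / 2 ≤ ((N - 1 : ℕ) : ℝ) := by rw [hd]; linarith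
  have hdN' : ((N - 1 : ℕ) : ℝ) ≤ N := by rw [hd]; linarith
  have hd0 := cast_pred_pos hN2
  have hp : 0 ≤ 2 * α - 1 := by linarith
  have hC := shortConst_nonneg (by linarith : 0 ≤ α)
  have hvp : 0 < v := by linarith
  have hvN : v ≤ N := hv ▸ le_self_pow₀ hv0 (by norm_num)
  set r : ℕ := ⌈v⌉₊ with hr
  have hr1 : v ≤ r := Nat.le_ceil v
  have hr2 : (r : ℝ) ≤ 2 * v := by linarith [Nat.ceil_lt_add_one hvp.le]
  set m : ℕ := N * r with hm
  have hmr : (m : ℝ) = N * r := by rw [hm, Nat.cast_mul]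
  set s : ℝ := (v ^ 6)⁻¹ with hs_def
  have hs : 0 < s := by positivity
  have hmd : (m : ℝ) / ((N - 1 : ℕ) : ℝ) ≤ 4 * v := by
    rw [div_le_iff₀ (by linarith), hmr]
    calc (N : ℝ) * r ≤ N * (2 * v) := by gcongr
      _ = 4 * v * (N / 2) := by ring
      _ ≤ _ := by gcongr
  have hmd' : v ≤ (m : ℝ) / ((N - 1 : ℕ) : ℝ) := by
    rw [le_div_iff₀ (by linarith), hmr, mul_comm]
    gcongr
  -- The merging steps cost the contraction only a factor `2`, because `m * gap N / (N - 1) ≤ 20 /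
  -- N`; this is where `40 ≤ N` comes from.
  have hrate : 1 / 2 ≤ contractionRate N ^ m := by
    have h1 : gap N / ((N - 1 : ℕ) : ℝ) ≤ 1 := by
      rw [div_le_one (by linarith)]
      refine (gap_le N).trans ?_
      rw [div_le_iff₀ (by positivity)]
      nlinarith
    have h2 := one_add_mul_le_pow (a := -(gap N / ((N - 1 : ℕ) : ℝ))) (by linarith) m
    have h3 : (m : ℝ) * (gap N / ((N - 1 : ℕ) : ℝ)) ≤ 1 / 2 := by
      calc (m : ℝ) * (gap N / ((N - 1 : ℕ) : ℝ)) = m / ((N - 1 : ℕ) : ℝ) * gap N := by ring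
        _ ≤ 4 * N * (5 / (N : ℝ) ^ 2) := by
            have := gap_le N
            gcongr
            exact hmd.trans (by linarith)
        _ = 20 / N := by field_simp; norm_num
        _ ≤ 1 / 2 := by rw [div_le_div_iff₀ (by linarith) two_pos]; linarith
    rw [contractionRate, sub_eq_add_neg]
    linarith
  have hrate0 : 0 < contractionRate N := by
    have h1 : gap N / ((N - 1 : ℕ) : ℝ) < 1 := by
      rw [div_lt_one (by linarith)]
      refine (gap_le N).trans_lt ?_
      rw [div_lt_iff₀ (by positivity)]
      nlinarith
    exact sub_pos.2 h1
  have hexp : Real.exp (-(gap N * (5 * Real.log N / gap N))) = (v ^ 20)⁻¹ := by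
    rw [mul_div_cancel₀ _ hgap.ne', Real.exp_neg, ← hv, Real.log_pow]
    rw [show (5 : ℝ) * ((4 : ℕ) * Real.log v) = (20 : ℕ) * Real.log v by push_cast; ring,
      Real.exp_nat_mul, Real.exp_log hvp]
  have ht : 0 ≤ 5 * Real.log N / gap N :=
    div_nonneg (mul_nonneg (by norm_num) (Real.log_natCast_nonneg N)) hgap.le
  refine (worstDist_le hN2 hα hs hrate0 m ht).trans ?_
  rw [hexp]
  have hdist : distError N α s m ≤ 4 * (2 * α - 1) * v ^ 19 := by
    calc distError N α s m
        = m / ((N - 1 : ℕ) : ℝ) * ((2 * α - 1) * v ^ 6 * (N : ℝ) ^ 3) := by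
          rw [distError, hs_def]; field_simp
      _ ≤ 4 * v * ((2 * α - 1) * v ^ 6 * (N : ℝ) ^ 3) := by gcongr
      _ = _ := by rw [← hv]; ring
  have hupd : updateError N α s m ≤ (120 + 2 * shortConst α) / v := by
    have h1 : (1 - 1 / ((N - 1 : ℕ) : ℝ)) ^ m ≤ Real.exp (-v) := by
      calc _ ≤ Real.exp (-(1 / ((N - 1 : ℕ) : ℝ))) ^ m := by
            have := Real.one_sub_le_exp_neg (1 / ((N - 1 : ℕ) : ℝ))
            gcongr
            rw [sub_nonneg, div_le_one (by linarith)]; exact hd0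
        _ = Real.exp (-(m / ((N - 1 : ℕ) : ℝ))) := by
            rw [← Real.exp_nat_mul]; congr 1; ring
        _ ≤ _ := Real.exp_le_exp.2 (neg_le_neg hmd')
    -- The constant is `5!`, from the degree-five term of the exponential series.
    have h2 : Real.exp (-v) * v ^ 4 ≤ 120 / v := by
      have := Real.pow_div_factorial_le_exp v hvp.le 5
      rw [Real.exp_neg, le_div_iff₀ hvp, mul_assoc, inv_mul_le_iff₀ (Real.exp_pos _), ← pow_succ,
        show v ^ (4 + 1) = v ^ 5 from rfl]
      norm_num [Nat.factorial] at this
      linarith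
    have h3 : (m : ℝ) * (s * shortConst α) ≤ 2 * shortConst α / v := by
      rw [hmr, ← hv, hs_def]
      calc v ^ 4 * r * ((v ^ 6)⁻¹ * shortConst α) ≤ v ^ 4 * (2 * v) * ((v ^ 6)⁻¹ * shortConst α) := by
            gcongr
        _ = _ := by field_simp
    calc updateError N α s m ≤ Real.exp (-v) * v ^ 4 + 2 * shortConst α / v := by
          unfold updateError
          rw [hv]
          gcongr
      _ ≤ 120 / v + 2 * shortConst α / v := by gcongr
      _ = _ := by ring
  have hmain : (distError N α s m + 1) / contractionRate N ^ m * (v ^ 20)⁻¹ ≤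
      (8 * (2 * α - 1) + 2) / v := by
    calc _ ≤ (4 * (2 * α - 1) * v ^ 19 + v ^ 19) / (1 / 2) * (v ^ 20)⁻¹ := by
          have := one_le_pow₀ hv0 (n := 19)
          have := distError_nonneg (N := N) hα hs m
          gcongr
      _ = _ := by field_simp; ring
  calc _ ≤ (120 + 2 * shortConst α) / v + (8 * (2 * α - 1) + 2) / v := add_le_add hupd hmain
    _ = _ := by ring

end BetaSimplex

theorem mainTheorem10 (α : ℝ) (hα : 1 ≤ α) (ε : ℝ) (hε : 0 < ε) :
    ∃ N₀ : ℕ, ∀ N : ℕ, N₀ ≤ N →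
      BetaSimplex.mixingTime N α ε ≤ ((5 * Real.log N / BetaSimplex.gap N : ℝ) : EReal) := by
  set K : ℝ := 8 * (2 * α - 1) + 2 + 120 + 2 * BetaSimplex.shortConst α with hK
  have hv : Tendsto (fun N : ℕ => (N : ℝ) ^ (1 / 4 : ℝ)) atTop atTop :=
    (tendsto_rpow_atTop (by norm_num)).comp tendsto_natCast_atTop_atTop
  obtain ⟨N₀, hN₀⟩ := eventually_atTop.1 ((eventually_ge_atTop 40).and
    ((hv.eventually_ge_atTop 1).and (hv.eventually_gt_atTop (K / ε))))
  refine ⟨N₀, fun N hN => ?_⟩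
  obtain ⟨h40, h1, h2⟩ := hN₀ N hN
  have hv4 : ((N : ℝ) ^ (1 / 4 : ℝ)) ^ 4 = N := by
    rw [← Real.rpow_natCast, ← Real.rpow_mul (Nat.cast_nonneg N)]
    norm_num
  have hgap := BetaSimplex.gap_pos (by omega : 1 ≤ N)
  refine sInf_le ⟨_, ⟨div_nonneg (mul_nonneg (by norm_num) (Real.log_natCast_nonneg N)) hgap.le,
    (BetaSimplex.worstDist_le_div h40 hα h1 hv4).trans_lt ?_⟩, rfl⟩
  rw [← hK, div_lt_iff₀ (by linarith)]
  rwa [div_lt_iff₀ hε, mul_comm] at h2
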